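/- Let $\xi>0$. For $\mathbf k\in\mathbb R^3\setminus\{0\}$ put $$\widehat H^{\mathrm F}(\mathbf k)=\frac{4\pi}{|\mathbf k|^2}e^{-|\mathbf k|^2/(2\xi)^2},\qquad \widehat B^{\mathrm F}(\mathbf k)=-\frac{8\pi}{|\mathbf k|^4}e^{-|\mathbf k|^2/(2\xi)^2}\Big(1+\frac{|\mathbf k|^2}{(2\xi)^2}\Big),$$ and, for $j,l,m\in\{1,2,3\}$ (summation over repeated indices, $\delta$ the Kronecker and $\epsilon$ the Levi-Civita symbol), let the Fourier transforms of the Fourier-space parts of the stokeslet, rotlet and stresslet be $$\widehat S^{\mathrm F}_{jl}=(-\delta_{jl}|\mathbf k|^2+k_jk_l)\widehat B^{\mathrm F},\qquad \widehat\Omega^{\mathrm F}_{jl}=-\epsilon_{jlm}\mathrm i k_m\widehat H^{\mathrm F},$$ $$\widehat T^{\mathrm F}_{jlm}=\big(-\mathrm i(\delta_{jl}k_m+\delta_{mj}k_l+\delta_{lm}k_j)|\mathbf k|^2+2\mathrm i k_jk_lk_m\big)\widehat B^{\mathrm F}.$$ The corresponding differential operators on $\mathbb R^3$ are $$\mathrm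 K^S_{jl}=\delta_{jl}\nabla^2-\nabla_j\nabla_l,\qquad \mathrm K^\Omega_{jl}=-\epsilon_{jlm}\nabla_m,\qquad \mathrm K^T_{jlm}=(\delta_{jl}\nabla_m+\delta_{mj}\nabla_l+\delta_{lm}\nabla_j)\nabla^2-2\nabla_j\nabla_l\nabla_m .$$ For each of $\widehat G=\widehat H^{\mathrm F},\widehat B^{\mathrm F},\widehat\Omega^{\mathrm F},\widehat S^{\mathrm F},\widehat T^{\mathrm F}$ (the last three tensor-valued) the following holds for the zero mode $$\frac1{2\pi}\int_{\mathbb R}\widehat G(0,0,\kappa_3)\,e^{\mathrm i\kappa_3r_3}\,d\kappa_3 .$$ (1) For no $r_3\in\mathbb R$ is the integrand Lebesgue integrable over $\mathbb R$. (2) The singular function $\widehat G(0,0,\cdot)$ defines (entrywise) a tempered distribution by the Hadamard finite part: $\langle \widehat G,\varphi\rangle=\mathrm{f.p.}\!\int \widehat G(0,0,\kappa)\varphi(\kappa)\,d\kappa$, the limit as $\varepsilon\to0^+$ of $\int_{|\kappa|>\varepsilon}\widehat G(0,0,\kappa)\varphi(\kappa)\,d\kappa$ after subtraction of a finite linear combination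 (depending on $\varphi$) of $\varepsilon^{-1},\varepsilon^{-2},\dots$ and $\log\varepsilon$. The inverse Fourier transform of this distribution, where $\langle\mathcal F^{-1}\tau,\varphi\rangle=\langle\tau,\mathcal F^{-1}\varphi\rangle$ and $\mathcal F^{-1}\varphi(\kappa)=\frac1{2\pi}\int\varphi(r)e^{\mathrm i\kappa r}dr$, is given by the function (with $\operatorname{erf}(x)=\frac2{\sqrt\pi}\int_0^xe^{-t^2}dt$) $$Q^{H,2\mathcal P,(0)}(r_3;\xi)=-2\pi\Big(r_3\operatorname{erf}(\xi r_3)+\frac{e^{-\xi^2r_3^2}}{\sqrt\pi\,\xi}\Big)$$ for $\widehat H^{\mathrm F}$, $$Q^{B,2\mathcal P,(0)}(r_3;\xi)=-\frac{2\pi}3\Big(r_3^3\operatorname{erf}(\xi r_3)+\frac{e^{-\xi^2r_3^2}}{\sqrt\pi\,\xi}\Big(r_3^2-\frac1{2\xi^2}\Big)\Big)$$ for $\widehat B^{\mathrm F}$, $$Q^{\Omega,2\mathcal P,(0)}(r_3;\xi)=2\pi\operatorname{erf}(\xi r_3)\begin{bmatrix}0&1&0\\-1&0&0\\0&0&0\end{bmatrix}$$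 for the rotlet, $$Q^{S,2\mathcal P,(0)}(r_3;\xi)=-2\pi\Big(2r_3\operatorname{erf}(\xi r_3)+\frac{e^{-\xi^2r_3^2}}{\sqrt\pi\,\xi}\Big)\begin{bmatrix}1&0&0\\0&1&0\\0&0&0\end{bmatrix}$$ for the stokeslet, and $$Q^{T,2\mathcal P,(0)}_{jlm}(r_3;\xi)=-4\pi\Big(\operatorname{erf}(\xi r_3)+\frac{\xi r_3}{\sqrt\pi}e^{-\xi^2r_3^2}\Big)C_{jlm}$$ for the stresslet, where $$C_{1lm}=\begin{bmatrix}0&0&1\\0&0&0\\1&0&0\end{bmatrix}_{lm},\quad C_{2lm}=\begin{bmatrix}0&0&0\\0&0&1\\0&1&0\end{bmatrix}_{lm},\quad C_{3lm}=\begin{bmatrix}1&0&0\\0&1&0\\0&0&1\end{bmatrix}_{lm}.$$ (3) $Q^{H,2\mathcal P,(0)}$ and $Q^{B,2\mathcal P,(0)}$ are smooth functions of $r_3$ and, regarded as functions of $\mathbf r=(r_1,r_2,r_3)\in\mathbb R^3$, they satisfy pointwise $$Q^{\Omega,2\mathcal P,(0)}_{jl}=\mathrm K^\Omega_{jl}Q^{H,2\mathcal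 P,(0)},\qquad Q^{S,2\mathcal P,(0)}_{jl}=\mathrm K^S_{jl}Q^{B,2\mathcal P,(0)},\qquad Q^{T,2\mathcal P,(0)}_{jlm}=\mathrm K^T_{jlm}Q^{B,2\mathcal P,(0)} .$$ -/

import Mathlib

open MeasureTheory Filter Topology SchwartzMap FourierTransform
open scoped ContDiff

noncomputable section

namespace ZeroMode

/-! ## Hadamard finite parts on the real line -/

/-- `L` is the Hadamard finite part at the origin of `∫ f`: the integral of `f` over
`{|x| > ε}` exists for all `ε > 0`, and it converges to `L` as `ε → 0+` once a finite combination
of the divergent terms `ε⁻¹, ε⁻², …` and `log ε` has been subtracted. -/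
def HasFinitePart (f : ℝ → ℂ) (L : ℂ) : Prop :=
  (∀ ε : ℝ, 0 < ε → IntegrableOn f {x : ℝ | ε < |x|}) ∧
    ∃ (P : Polynomial ℂ) (b : ℂ), P.coeff 0 = 0 ∧
      Tendsto (fun ε : ℝ => (∫ x in {x : ℝ | ε < |x|}, f x)
        - P.eval ((ε⁻¹ : ℝ) : ℂ) - b * (Real.log ε : ℂ)) (𝓝[>] 0) (𝓝 L)

/-- A combination of `ε⁻¹, ε⁻², …` and `log ε` that has a limit as `ε → 0+` has limit zero. -/
theorem divergent_limit_eq_zero (P : Polynomial ℂ) (b M : ℂ) (hP : P.coeff 0 = 0)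
    (h : Tendsto (fun ε : ℝ => P.eval ((ε⁻¹ : ℝ) : ℂ) + b * (Real.log ε : ℂ))
      (𝓝[>] 0) (𝓝 M)) : M = 0 := by
  have hx : Tendsto (fun x : ℝ => P.eval (x : ℂ) - b * (Real.log x : ℂ)) atTop (𝓝 M) := by
    refine (h.comp tendsto_inv_atTop_nhdsGT_zero).congr fun x => ?_
    simp [Real.log_inv, sub_eq_add_neg]
  have hn : Tendsto (fun x : ℝ => ‖(x : ℂ)‖) atTop atTop := by
    simpa using tendsto_abs_atTop_atTop
  -- compare the values at `2 x` and at `x`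
  set R : Polynomial ℂ := P.comp (Polynomial.C 2 * Polynomial.X) - P
    - Polynomial.C (b * (Real.log 2 : ℂ)) with hR
  have hRx : Tendsto (fun x : ℝ => R.eval (x : ℂ)) atTop (𝓝 0) := by
    have h2 : Tendsto (fun x : ℝ => 2 * x) atTop atTop :=
      tendsto_id.const_mul_atTop (by norm_num)
    have h3 := (hx.comp h2).sub hx
    rw [sub_self] at h3
    refine h3.congr' ?_
    filter_upwards [eventually_gt_atTop 0] with x hx0
    simp only [Function.comp, hR, Polynomial.eval_sub, Polynomial.eval_comp, Polynomial.eval_mul,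
      Polynomial.eval_C, Polynomial.eval_X]
    rw [Real.log_mul (by norm_num) hx0.ne']
    push_cast
    ring
  have hdeg : R.degree ≤ 0 := by
    by_contra hd
    exact not_tendsto_nhds_of_tendsto_atTop
      (Polynomial.tendsto_norm_atTop R (not_le.mp hd) hn) _ hRx.norm
  have hR0 : R = 0 := by
    rw [Polynomial.eq_C_of_degree_le_zero hdeg] at hRx ⊢
    have h0 : R.coeff 0 = 0 := by simpa using hRx
    rw [h0, map_zero]
  have hcoef : ∀ n, P.coeff n = 0 := by
    intro n
    rcases Nat.eq_zero_or_pos n with rfl | hn'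
    · exact hP
    · have h1 : R.coeff n = 0 := by rw [hR0]; simp
      rw [hR, Polynomial.coeff_sub, Polynomial.coeff_sub, Polynomial.comp_C_mul_X_coeff,
        Polynomial.coeff_C, if_neg hn'.ne', sub_zero] at h1
      have h2 : P.coeff n * ((2 : ℂ) ^ n - 1) = 0 := by rw [← h1]; ring
      rcases mul_eq_zero.mp h2 with h3 | h3
      · exact h3
      · exfalso
        have h4 : (2 : ℂ) ^ n = 1 := sub_eq_zero.mp h3
        have h5 : (2 : ℕ) ^ n = 1 := by exact_mod_cast h4
        have h6 := Nat.one_lt_two_pow hn'.ne'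
        omega
  have hP0 : P = 0 := Polynomial.ext (by simpa using hcoef)
  have hb : b = 0 := by
    have h1 : R.eval 0 = 0 := by rw [hR0]; simp
    rw [hR, hP0] at h1
    have h2 : b * (Real.log 2 : ℂ) = 0 := by
      simpa only [Polynomial.zero_comp, sub_zero, zero_sub, Polynomial.eval_neg,
        Polynomial.eval_C, neg_eq_zero] using h1
    refine (mul_eq_zero.mp h2).resolve_right ?_
    exact_mod_cast (Real.log_pos one_lt_two).ne'
  rw [hP0, hb] at hx
  simpa using (tendsto_nhds_unique hx (by simp))

/-- The finite part is unique. -/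
theorem HasFinitePart.unique {f : ℝ → ℂ} {L L' : ℂ} (h : HasFinitePart f L)
    (h' : HasFinitePart f L') : L = L' := by
  obtain ⟨-, P, b, hP, hL⟩ := h
  obtain ⟨-, P', b', hP', hL'⟩ := h'
  have h1 := hL'.sub hL
  have h2 := divergent_limit_eq_zero (P - P') (b - b') (L' - L) (by simp [hP, hP'])
    (h1.congr fun ε => by simp only [Polynomial.eval_sub]; ring)
  exact (sub_eq_zero.mp h2).symm

/-- The tempered distribution `T` is the finite part of the function `g`, which may have a
non-integrable singularity at the origin: `⟨T, φ⟩ = f.p. ∫ g φ` for every Schwartz function `φ`. -/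
def IsFinitePart (g : ℝ → ℂ) (T : 𝓢'(ℝ, ℂ)) : Prop :=
  ∀ φ : 𝓢(ℝ, ℂ), HasFinitePart (fun κ => g κ * φ κ) (T φ)

theorem IsFinitePart.unique {g : ℝ → ℂ} {T T' : 𝓢'(ℝ, ℂ)} (h : IsFinitePart g T)
    (h' : IsFinitePart g T') : T = T' := by
  ext φ
  exact (h φ).unique (h' φ)

/-! ## The distributional inverse Fourier transform, with kernel `(2π)⁻¹ exp(i κ r)` -/

/-- Multiplication by `(2π)⁻¹` on the real line. -/
def scaling : ℝ ≃L[ℝ] ℝ :=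
  ContinuousLinearEquiv.smulLeft (Units.mk0 ((2 * Real.pi)⁻¹) (by positivity))

/-- The inverse Fourier transform on Schwartz functions, normalized as in
`invFourierSchwartz_apply`. -/
def invFourierSchwartz : 𝓢(ℝ, ℂ) →L[ℂ] 𝓢(ℝ, ℂ) :=
  ((2 * Real.pi : ℂ)⁻¹) •
    ((compCLMOfContinuousLinearEquiv ℂ scaling).comp (fourierInvCLM ℂ 𝓢(ℝ, ℂ)))

theorem invFourierSchwartz_apply (φ : 𝓢(ℝ, ℂ)) (r : ℝ) :
    invFourierSchwartz φ r
      = (2 * Real.pi : ℂ)⁻¹ * ∫ κ : ℝ, φ κ * Complex.exp (Complex.I * κ * r) := by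
  have h : invFourierSchwartz φ r = (2 * Real.pi : ℂ)⁻¹ * (𝓕⁻ φ) ((2 * Real.pi)⁻¹ * r) := rfl
  rw [h, fourierInv_coe, Real.fourierInv_eq']
  congr 1
  refine integral_congr_ae (Eventually.of_forall fun κ => ?_)
  have hpi : (Real.pi : ℂ) ≠ 0 := by exact_mod_cast Real.pi_ne_zero
  simp only [smul_eq_mul, RCLike.inner_apply, conj_trivial]
  rw [mul_comm]
  congr 2
  push_cast
  field_simp

/-- The inverse Fourier transform of a tempered distribution,
`⟨F⁻¹ T, φ⟩ = ⟨T, F⁻¹ φ⟩`. -/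
def invFourier (T : 𝓢'(ℝ, ℂ)) : 𝓢'(ℝ, ℂ) :=
  PointwiseConvergenceCLM.precomp ℂ invFourierSchwartz T

theorem invFourier_apply (T : 𝓢'(ℝ, ℂ)) (φ : 𝓢(ℝ, ℂ)) :
    invFourier T φ = T (invFourierSchwartz φ) := rfl

/-- The tempered distribution `T` is given by the function `q`. -/
def IsGivenBy (T : 𝓢'(ℝ, ℂ)) (q : ℝ → ℂ) : Prop :=
  ∀ φ : 𝓢(ℝ, ℂ), Integrable (fun r => q r * φ r) ∧ T φ = ∫ r, q r * φ r

/-- In the sense of distributions, `(2π)⁻¹ ∫ g(κ) exp(i κ r) dκ = q(r)`: the finite part of `g` is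
a tempered distribution, and its inverse Fourier transform is the function `q`. -/
def HasInvFourier (g : ℝ → ℂ) (q : ℝ → ℂ) : Prop :=
  ∃ T : 𝓢'(ℝ, ℂ), IsFinitePart g T ∧ IsGivenBy (invFourier T) q

/-! ## Kernels in Fourier space -/

/-- Three-dimensional space. -/
abbrev E3 : Type := EuclideanSpace ℝ (Fin 3)

/-- The Kronecker delta. -/
def kron (j l : Fin 3) : ℝ := if j = l then 1 else 0

/-- The Levi-Civita symbol. -/
def levi (j l m : Fin 3) : ℝ :=
  (((l : ℕ) : ℝ) - ((j : ℕ) : ℝ)) * (((m : ℕ) : ℝ) - ((j : ℕ) : ℝ))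
    * (((m : ℕ) : ℝ) - ((l : ℕ) : ℝ)) / 2

/-- Fourier transform of the harmonic kernel `1 / |r|`. -/
def harmonicHat (k : E3) : ℝ := 4 * Real.pi / ‖k‖ ^ 2

/-- Fourier transform of the biharmonic kernel `|r|`. -/
def biharmonicHat (k : E3) : ℝ := -(8 * Real.pi / ‖k‖ ^ 4)

/-- Fourier transform of the Ewald screening function. -/
def ewaldHat (ξ : ℝ) (k : E3) : ℝ := Real.exp (-(‖k‖ ^ 2 / (2 * ξ) ^ 2))

/-- Fourier transform of the Hasimoto screening function. -/
def hasimotoHat (ξ : ℝ) (k : E3) : ℝ :=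
  Real.exp (-(‖k‖ ^ 2 / (2 * ξ) ^ 2)) * (1 + ‖k‖ ^ 2 / (2 * ξ) ^ 2)

/-- Symbol of the stokeslet operator. -/
def stokesletSymbol (j l : Fin 3) (k : E3) : ℂ :=
  ((-(kron j l * ‖k‖ ^ 2) + k j * k l : ℝ) : ℂ)

/-- Symbol of the rotlet operator. -/
def rotletSymbol (j l : Fin 3) (k : E3) : ℂ :=
  -∑ m : Fin 3, (levi j l m : ℂ) * Complex.I * (k m : ℂ)

/-- Symbol of the stresslet operator. -/
def stressletSymbol (j l m : Fin 3) (k : E3) : ℂ :=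
  -Complex.I * ((kron j l * k m + kron m j * k l + kron l m * k j : ℝ) : ℂ) * (‖k‖ : ℂ) ^ 2
    + 2 * Complex.I * ((k j * k l * k m : ℝ) : ℂ)

/-- Fourier transform of the Fourier-space part of the harmonic kernel. -/
def harmonicFHat (ξ : ℝ) (k : E3) : ℂ := ((harmonicHat k * ewaldHat ξ k : ℝ) : ℂ)

/-- Fourier transform of the Fourier-space part of the biharmonic kernel. -/
def biharmonicFHat (ξ : ℝ) (k : E3) : ℂ := ((biharmonicHat k * hasimotoHat ξ k : ℝ) : ℂ)

/-- Fourier transform of the Fourier-space part of the stokeslet. -/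
def stokesletFHat (ξ : ℝ) (k : E3) (j l : Fin 3) : ℂ :=
  stokesletSymbol j l k * biharmonicFHat ξ k

/-- Fourier transform of the Fourier-space part of the rotlet. -/
def rotletFHat (ξ : ℝ) (k : E3) (j l : Fin 3) : ℂ :=
  rotletSymbol j l k * harmonicFHat ξ k

/-- Fourier transform of the Fourier-space part of the stresslet. -/
def stressletFHat (ξ : ℝ) (k : E3) (j l m : Fin 3) : ℂ :=
  stressletSymbol j l m k * biharmonicFHat ξ k

/-- The wave vector `(0, 0, κ)` of the zero mode in the doubly periodic case. -/
def zeroModeVec (κ : ℝ) : E3 := !₂[0, 0, κ]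

/-! ## Differential operators in real space -/

/-- Partial derivative in the coordinate direction `j`. -/
def pd (j : Fin 3) (f : E3 → ℝ) : E3 → ℝ :=
  fun r => fderiv ℝ f r (EuclideanSpace.single j 1)

/-- The Laplace operator. -/
def lap (f : E3 → ℝ) : E3 → ℝ := fun r => ∑ i : Fin 3, pd i (pd i f) r

/-- The stokeslet operator `δ_jl ∇² - ∇_j ∇_l`. -/
def stokesletOp (j l : Fin 3) (f : E3 → ℝ) : E3 → ℝ :=
  fun r => kron j l * lap f r - pd j (pd l f) r

/-- The rotlet operator `-ε_jlm ∇_m`. -/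
def rotletOp (j l : Fin 3) (f : E3 → ℝ) : E3 → ℝ :=
  fun r => -∑ m : Fin 3, levi j l m * pd m f r

/-- The stresslet operator
`(δ_jl ∇_m + δ_mj ∇_l + δ_lm ∇_j) ∇² - 2 ∇_j ∇_l ∇_m`. -/
def stressletOp (j l m : Fin 3) (f : E3 → ℝ) : E3 → ℝ :=
  fun r => kron j l * pd m (lap f) r + kron m j * pd l (lap f) r + kron l m * pd j (lap f) r
    - 2 * pd j (pd l (pd m f)) r

/-- A function of the free coordinate `r₃`, viewed as a function on space. -/
def ofFree (q : ℝ → ℝ) : E3 → ℝ := fun r => q (r 2)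

/-! ## The closed formulas -/

/-- The error function. -/
def erf (x : ℝ) : ℝ := 2 / Real.sqrt Real.pi * ∫ t in (0 : ℝ)..x, Real.exp (-t ^ 2)

/-- The zero mode of the harmonic kernel. -/
def QH (ξ r : ℝ) : ℝ :=
  -(2 * Real.pi) * (r * erf (ξ * r) + Real.exp (-(ξ ^ 2 * r ^ 2)) / (Real.sqrt Real.pi * ξ))

/-- The zero mode of the biharmonic kernel. -/
def QB (ξ r : ℝ) : ℝ :=
  -(2 * Real.pi / 3) * (r ^ 3 * erf (ξ * r)
    + Real.exp (-(ξ ^ 2 * r ^ 2)) / (Real.sqrt Real.pi * ξ) * (r ^ 2 - 1 / (2 * ξ ^ 2)))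

/-- The zero mode of the rotlet. -/
def QRotlet (ξ r : ℝ) (j l : Fin 3) : ℝ :=
  2 * Real.pi * erf (ξ * r) * !![0, 1, 0; -1, 0, 0; 0, 0, 0] j l

/-- The zero mode of the stokeslet. -/
def QStokeslet (ξ r : ℝ) (j l : Fin 3) : ℝ :=
  -(2 * Real.pi) * (2 * r * erf (ξ * r)
    + Real.exp (-(ξ ^ 2 * r ^ 2)) / (Real.sqrt Real.pi * ξ))
    * !![1, 0, 0; 0, 1, 0; 0, 0, 0] j l

/-- The constant tensor in the zero mode of the stresslet; `CT j` is the matrix with entries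
`C_jlm`, for `l` the row and `m` the column. -/
def CT : Fin 3 → Matrix (Fin 3) (Fin 3) ℝ :=
  ![!![0, 0, 1; 0, 0, 0; 1, 0, 0],
    !![0, 0, 0; 0, 0, 1; 0, 1, 0],
    !![1, 0, 0; 0, 1, 0; 0, 0, 1]]

/-- The zero mode of the stresslet. -/
def QStresslet (ξ r : ℝ) (j l m : Fin 3) : ℝ :=
  -(4 * Real.pi) * (erf (ξ * r)
    + ξ * r / Real.sqrt Real.pi * Real.exp (-(ξ ^ 2 * r ^ 2))) * CT j l m

end ZeroMode

end

/-!
Along the free coordinate every kernel is a multiple of `e / κ`, `e / κ²`, `w / κ`, `w / κ²` or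
`w / κ⁴`, where `e = exp (-κ² / (2ξ)²)` and `w = e (1 + κ² / (2ξ)²)`. Since `e` and `w` equal `1` at
the origin, none of these is integrable.

A distributional inverse Fourier transform is established by testing in real space
(`IsFourierPair`): the finite part of `g` has the inverse Fourier transform `q` if
`f.p. ∫ g F⁻¹ψ = ∫ q ψ` for all Schwartz functions `ψ`. For `q` of temperate growth the distribution
itself is then `φ ↦ ∫ q Fφ`, with `F` the inverse of `F⁻¹`, so that its continuity needs no estimate
on finite parts (`IsFourierPair.hasInvFourier`).

All transforms come from two of them. The Gaussian has a classical transform. The principal value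
of `e / κ` has the transform `(i/2) erf (ξ r)` (`isFourierPair_gaussHat_div`): by Fubini's theorem
it is `(2π)⁻¹ ∫ e (exp (i κ r) - 1) / κ`, which vanishes at `r = 0` and whose derivative is `i`
times the transform of the Gaussian.

Higher powers of `κ⁻¹` are reached by integration by parts
(`HasFinitePart.mul_div_pow_succ`, `IsFourierPair.mul_div_pow_succ`): if `w / κⁿ` and `w' / κⁿ` have
the transforms `q` and `q'`, then `n w / κⁿ⁺¹` has the transform `i r q + q'`. The finite part
produces no additional term, because the Taylor coefficient of order `n` cancels between the
boundary terms at `ε` and `-ε`, and what remains is a polynomial in `ε⁻¹` without constant term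
(`exists_polynomial_boundary`). As `e'` is a multiple of `κ e`, and `w'` of `κ³ e`, the second
transform is a Gaussian, up to a power of `r`, at every step.

The differential relations reduce to derivatives in `r₃`: the stokeslet and stresslet profiles are
the second and third derivative of `QB`, and `QH` has the derivative `-2π erf (ξ r)`.
-/

namespace ZeroMode

/-! ### Finite parts -/

theorem measurableSet_outside (ε : ℝ) : MeasurableSet {x : ℝ | ε < |x|} :=
  (isOpen_lt continuous_const continuous_abs).measurableSet

theorem HasFinitePart.congr {f f' : ℝ → ℂ} {L : ℂ} (h : HasFinitePart f L)
    (hff' : ∀ x, x ≠ 0 → f' x = f x) : HasFinitePart f' L := by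
  have heq : ∀ ε : ℝ, 0 < ε → Set.EqOn f f' {x : ℝ | ε < |x|} := by
    intro ε hε x hx
    exact (hff' x (abs_pos.mp (hε.trans hx))).symm
  obtain ⟨hi, P, b, hP, hL⟩ := h
  refine ⟨fun ε hε => (hi ε hε).congr_fun (heq ε hε) (measurableSet_outside ε), P, b, hP,
    hL.congr' ?_⟩
  filter_upwards [self_mem_nhdsWithin] with ε hε
  rw [setIntegral_congr_fun (measurableSet_outside ε) (heq ε hε)]

theorem HasFinitePart.add {f f' : ℝ → ℂ} {L L' : ℂ} (h : HasFinitePart f L)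
    (h' : HasFinitePart f' L') : HasFinitePart (fun x => f x + f' x) (L + L') := by
  obtain ⟨hi, P, b, hP, hL⟩ := h
  obtain ⟨hi', P', b', hP', hL'⟩ := h'
  refine ⟨fun ε hε => (hi ε hε).add (hi' ε hε), P + P', b + b', by simp [hP, hP'],
    (hL.add hL').congr' ?_⟩
  filter_upwards [self_mem_nhdsWithin] with ε hε
  rw [integral_add (hi ε hε) (hi' ε hε), Polynomial.eval_add]
  ring

theorem HasFinitePart.const_mul {f : ℝ → ℂ} {L : ℂ} (c : ℂ) (h : HasFinitePart f L) :
    HasFinitePart (fun x => c * f x) (c * L) := by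
  obtain ⟨hi, P, b, hP, hL⟩ := h
  refine ⟨fun ε hε => (hi ε hε).const_mul c, Polynomial.C c * P, c * b, by simp [hP],
    (hL.const_mul c).congr fun ε => ?_⟩
  rw [integral_const_mul, Polynomial.eval_mul, Polynomial.eval_C]
  ring

/-- A function whose integrals over `{|x| > ε}` converge has that limit as its finite part. -/
theorem HasFinitePart.of_tendsto {f : ℝ → ℂ} {L : ℂ}
    (hi : ∀ ε : ℝ, 0 < ε → IntegrableOn f {x : ℝ | ε < |x|})
    (hL : Tendsto (fun ε : ℝ => ∫ x in {x : ℝ | ε < |x|}, f x) (𝓝[>] 0) (𝓝 L)) :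
    HasFinitePart f L :=
  ⟨hi, 0, 0, by simp, hL.congr fun ε => by simp⟩

theorem tendsto_setIntegral_outside {f : ℝ → ℂ} (hf : Integrable f) :
    Tendsto (fun ε : ℝ => ∫ x in {x : ℝ | ε < |x|}, f x) (𝓝[>] 0) (𝓝 (∫ x, f x)) := by
  simp_rw [← integral_indicator (measurableSet_outside _)]
  refine tendsto_integral_filter_of_dominated_convergence (fun x => ‖f x‖)
    (Eventually.of_forall fun ε => hf.aestronglyMeasurable.indicator (measurableSet_outside ε))
    (Eventually.of_forall fun ε => Eventually.of_forall fun x => norm_indicator_le_norm_self f x)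
    hf.norm ?_
  filter_upwards [Measure.ae_ne volume 0] with x hx
  refine tendsto_const_nhds.congr' ?_
  filter_upwards [Ioo_mem_nhdsGT (abs_pos.mpr hx)] with ε hε
  exact (Set.indicator_of_mem (s := {x : ℝ | ε < |x|}) hε.2 f).symm

theorem HasFinitePart.of_integrable {f : ℝ → ℂ} (hf : Integrable f) :
    HasFinitePart f (∫ x, f x) :=
  .of_tendsto (fun _ _ => hf.integrableOn) (tendsto_setIntegral_outside hf)

theorem HasFinitePart.of_integrable' {f : ℝ → ℂ} {L : ℂ} (hf : Integrable f) (hL : ∫ x, f x = L) :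
    HasFinitePart f L := hL ▸ .of_integrable hf

theorem setOf_lt_abs (ε : ℝ) : {x : ℝ | ε < |x|} = Set.Iio (-ε) ∪ Set.Ioi ε := by
  ext x
  simp only [Set.mem_ofPred_eq, lt_abs, Set.mem_union, Set.mem_Iio, Set.mem_Ioi]
  constructor <;> rintro (h | h)
  · exact .inr h
  · exact .inl (by linarith)
  · exact .inr (by linarith)
  · exact .inl h

theorem integrableOn_div_pow {F : ℝ → ℂ} (hF : Integrable F) (n : ℕ) {ε : ℝ} (hε : 0 < ε) :
    IntegrableOn (fun x : ℝ => F x / (x : ℂ) ^ n) {x : ℝ | ε < |x|} := by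
  have h : IntegrableOn (fun x : ℝ => ((x : ℂ) ^ n)⁻¹ * F x) {x : ℝ | ε < |x|} := by
    refine Integrable.bdd_mul (c := (ε ^ n)⁻¹) hF.integrableOn ?_ ?_
    · exact Measurable.aestronglyMeasurable (by fun_prop)
    · filter_upwards [ae_restrict_mem (measurableSet_outside ε)] with x hx
      rw [norm_inv, norm_pow, Complex.norm_real, Real.norm_eq_abs]
      have hx' : ε < |x| := hx
      gcongr
  exact h.congr_fun (fun x _ => by simp only [div_eq_mul_inv, mul_comm]) (measurableSet_outside ε)

/-- The boundary terms of an integration by parts over `{|x| > ε}` against `x⁻ⁿ` are divergent,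
without a constant term: in the Taylor expansion of `G` of order `n`, the coefficient of `εⁿ`
contributes equally at `ε` and at `-ε`. -/
theorem exists_polynomial_boundary {G : ℝ → ℂ} (n : ℕ) (hG : ContDiff ℝ n G) :
    ∃ P : Polynomial ℂ, P.coeff 0 = 0 ∧
      Tendsto (fun ε : ℝ => (G ε / (ε : ℂ) ^ n - G (-ε) / ((-ε : ℝ) : ℂ) ^ n)
        - P.eval ((ε⁻¹ : ℝ) : ℂ)) (𝓝[>] 0) (𝓝 0) := by
  set c : ℕ → ℂ := fun k => ((k.factorial : ℂ))⁻¹ * iteratedDerivWithin k G Set.univ 0 with hc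
  have hlim : Tendsto (fun x : ℝ => G x / (x : ℂ) ^ n
      - ∑ k ∈ Finset.range (n + 1), c k * (x : ℂ) ^ k / (x : ℂ) ^ n) (𝓝 0) (𝓝 0) := by
    have h := taylor_tendsto convex_univ (Set.mem_univ (0 : ℝ)) hG.contDiffOn
    rw [nhdsWithin_univ] at h
    refine h.congr fun x => ?_
    rw [taylor_within_apply, Complex.real_smul, ← Finset.sum_div, ← sub_div, sub_zero]
    push_cast
    rw [div_eq_inv_mul]
    congr 2
    refine Finset.sum_congr rfl fun k _ => ?_
    rw [hc, Complex.real_smul]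
    push_cast
    ring
  refine ⟨∑ k ∈ Finset.range n, Polynomial.C (c k * (1 - (-1) ^ (n - k))) *
    Polynomial.X ^ (n - k), ?_, ?_⟩
  · rw [Polynomial.finsetSum_coeff]
    refine Finset.sum_eq_zero fun k hk => ?_
    have : n - k ≠ 0 := by have := Finset.mem_range.mp hk; omega
    rw [Polynomial.coeff_C_mul, Polynomial.coeff_X_pow, if_neg this.symm, mul_zero]
  · have h1 := hlim.mono_left (nhdsWithin_le_nhds (s := Set.Ioi 0))
    have hneg : Tendsto (fun ε : ℝ => -ε) (𝓝[>] 0) (𝓝 0) := by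
      simpa using (tendsto_neg (0 : ℝ)).mono_left (nhdsWithin_le_nhds (s := Set.Ioi 0))
    have h2 := h1.sub (hlim.comp hneg)
    rw [sub_zero] at h2
    refine h2.congr' ?_
    filter_upwards [self_mem_nhdsWithin] with ε hε
    have hε0 : (ε : ℂ) ≠ 0 := by exact_mod_cast (ne_of_gt hε)
    simp only [Function.comp_apply, Polynomial.eval_finsetSum, Polynomial.eval_mul,
      Polynomial.eval_C, Polynomial.eval_pow, Polynomial.eval_X]
    have key : ∑ k ∈ Finset.range (n + 1), c k * (ε : ℂ) ^ k / (ε : ℂ) ^ n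
        - ∑ k ∈ Finset.range (n + 1), c k * ((-ε : ℝ) : ℂ) ^ k / ((-ε : ℝ) : ℂ) ^ n
        = ∑ k ∈ Finset.range n, c k * (1 - (-1) ^ (n - k)) * ((ε⁻¹ : ℝ) : ℂ) ^ (n - k) := by
      have hterm : ∀ z : ℂ, z ≠ 0 → ∀ k ≤ n, c k * z ^ k / z ^ n = c k * z⁻¹ ^ (n - k) := by
        intro z hz k hk
        rw [mul_div_assoc, inv_pow, pow_sub₀ _ hz hk, mul_inv, inv_inv, div_eq_mul_inv,
          mul_comm (z ^ k)]
      have hε1 : ((-ε : ℝ) : ℂ) ≠ 0 := by simpa using hε0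
      rw [← Finset.sum_sub_distrib, Finset.sum_range_succ]
      rw [hterm _ hε0 n le_rfl, hterm _ hε1 n le_rfl]
      simp only [Nat.sub_self, pow_zero, sub_self, add_zero]
      refine Finset.sum_congr rfl fun k hk => ?_
      have hk' := (Finset.mem_range.mp hk).le
      rw [hterm _ hε0 k hk', hterm _ hε1 k hk']
      have : ((-ε : ℝ) : ℂ)⁻¹ = (-1) * ((ε⁻¹ : ℝ) : ℂ) := by push_cast; rw [inv_neg]; ring
      rw [this, mul_pow]
      push_cast
      ring
    rw [← key]
    ring

theorem tendsto_div_pow_zero {F : ℝ → ℂ} {l : Filter ℝ} (hF : Tendsto F l (𝓝 0)) (n : ℕ)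
    (hl : Tendsto (fun x : ℝ => |x|) l atTop) :
    Tendsto (fun x : ℝ => F x / (x : ℂ) ^ n) l (𝓝 0) := by
  refine squeeze_zero_norm' ?_ (tendsto_zero_iff_norm_tendsto_zero.mp hF)
  filter_upwards [hl.eventually_ge_atTop 1] with x hx
  rw [norm_div, norm_pow, Complex.norm_real, Real.norm_eq_abs]
  exact div_le_self (norm_nonneg _) (one_le_pow₀ hx)

/-- Integration by parts for finite parts: `f.p. ∫ n G x⁻ⁿ⁻¹ = f.p. ∫ G' x⁻ⁿ`. -/
theorem HasFinitePart.mul_div_pow_succ (G : 𝓢(ℝ, ℂ)) (n : ℕ) {L : ℂ}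
    (h : HasFinitePart (fun x : ℝ => deriv G x / (x : ℂ) ^ n) L) :
    HasFinitePart (fun x : ℝ => n * (G x / (x : ℂ) ^ (n + 1))) L := by
  have hiG : ∀ ε : ℝ, 0 < ε →
      IntegrableOn (fun x : ℝ => n * (G x / (x : ℂ) ^ (n + 1))) {x : ℝ | ε < |x|} :=
    fun ε hε => (integrableOn_div_pow G.integrable (n + 1) hε).const_mul _
  obtain ⟨hi, P, b, hP, hL⟩ := h
  obtain ⟨R, hR, hRL⟩ := exists_polynomial_boundary n (G.smooth n)
  refine ⟨hiG, P + R, b, by simp [hP, hR], ?_⟩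
  have h3 := hL.add hRL
  rw [add_zero] at h3
  refine h3.congr' ?_
  filter_upwards [self_mem_nhdsWithin] with ε hε
  have hε' : (0 : ℝ) < ε := hε
  have hdiv : ∀ x : ℝ, x ≠ 0 → HasDerivAt (fun x : ℝ => G x / (x : ℂ) ^ n)
      (deriv G x / (x : ℂ) ^ n - n * (G x / (x : ℂ) ^ (n + 1))) x := by
    intro x hx
    have hx' : (x : ℂ) ≠ 0 := by exact_mod_cast hx
    have h1 : HasDerivAt (fun x : ℝ => (x : ℂ) ^ n) (n * (x : ℂ) ^ (n - 1)) x := by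
      simpa using (hasDerivAt_id x).ofReal_comp.fun_pow n
    refine ((G.hasDerivAt x).div h1 (pow_ne_zero n hx')).congr_deriv ?_
    rcases n with _ | m
    · simp
    · rw [Nat.add_sub_cancel]
      field_simp
      ring
  have hint : IntegrableOn (fun x : ℝ => deriv G x / (x : ℂ) ^ n
      - n * (G x / (x : ℂ) ^ (n + 1))) {x : ℝ | ε < |x|} := (hi ε hε').sub (hiG ε hε')
  rw [setOf_lt_abs, integrableOn_union] at hint
  have htop := integral_Ioi_of_hasDerivAt_of_tendsto (a := ε)
    (hdiv ε hε'.ne').continuousAt.continuousWithinAt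
    (fun x hx => hdiv x (hε'.trans hx).ne') hint.2
    (tendsto_div_pow_zero (G.tendsto_cocompact.mono_left atTop_le_cocompact) n
      tendsto_abs_atTop_atTop)
  have hbot := integral_Iic_of_hasDerivAt_of_tendsto (a := -ε)
    (hdiv (-ε) (neg_ne_zero.mpr hε'.ne')).continuousAt.continuousWithinAt
    (fun x hx => hdiv x (ne_of_lt (lt_trans hx (neg_lt_zero.mpr hε'))))
    (integrableOn_Iic_iff_integrableOn_Iio (μ := volume) |>.mpr hint.1)
    (tendsto_div_pow_zero (G.tendsto_cocompact.mono_left atBot_le_cocompact) n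
      tendsto_abs_atBot_atTop)
  have hdisj : Disjoint (Set.Iio (-ε)) (Set.Ioi ε) :=
    Set.disjoint_left.mpr fun x (hx : x < -ε) (hx' : ε < x) => by linarith
  have htot : (∫ x in {x : ℝ | ε < |x|}, deriv G x / (x : ℂ) ^ n)
      - ∫ x in {x : ℝ | ε < |x|}, n * (G x / (x : ℂ) ^ (n + 1))
      = G (-ε) / ((-ε : ℝ) : ℂ) ^ n - G ε / (ε : ℂ) ^ n := by
    rw [← integral_sub (hi ε hε') (hiG ε hε'), setOf_lt_abs,
      setIntegral_union hdisj measurableSet_Ioi hint.1 hint.2, ← integral_Iic_eq_integral_Iio,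
      htop, hbot]
    ring
  rw [Polynomial.eval_add]
  linear_combination htot

/-! ### Pairs of a singular function and its inverse Fourier transform -/

/-- The Fourier transform on Schwartz functions inverse to `invFourierSchwartz`. -/
noncomputable def fourierSchwartz : 𝓢(ℝ, ℂ) →L[ℂ] 𝓢(ℝ, ℂ) :=
  (2 * Real.pi : ℂ) •
    ((fourierCLM ℂ 𝓢(ℝ, ℂ)).comp (compCLMOfContinuousLinearEquiv ℂ scaling.symm))

theorem complex_two_pi_ne_zero : (2 * Real.pi : ℂ) ≠ 0 := by
  exact_mod_cast (by positivity : (2 * Real.pi : ℝ) ≠ 0)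

theorem invFourierSchwartz_fourierSchwartz (φ : 𝓢(ℝ, ℂ)) :
    invFourierSchwartz (fourierSchwartz φ) = φ := by
  ext x
  have h : invFourierSchwartz (fourierSchwartz φ) = compCLMOfContinuousLinearEquiv ℂ scaling
      (𝓕⁻ (𝓕 (compCLMOfContinuousLinearEquiv ℂ scaling.symm φ))) := by
    simp [invFourierSchwartz, fourierSchwartz, map_smul, smul_smul, -mul_inv_rev]
  rw [h, FourierTransform.fourierInv_fourier_eq]
  simp

theorem fourierSchwartz_invFourierSchwartz (φ : 𝓢(ℝ, ℂ)) :
    fourierSchwartz (invFourierSchwartz φ) = φ := by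
  have h : fourierSchwartz (invFourierSchwartz φ) = 𝓕 (compCLMOfContinuousLinearEquiv ℂ
      scaling.symm (compCLMOfContinuousLinearEquiv ℂ scaling (𝓕⁻ φ))) := by
    simp [invFourierSchwartz, fourierSchwartz, map_smul, smul_smul, -mul_inv_rev]
  have h' : compCLMOfContinuousLinearEquiv ℂ scaling.symm
      (compCLMOfContinuousLinearEquiv ℂ scaling (𝓕⁻ φ)) = 𝓕⁻ φ := by
    ext x; simp
  rw [h, h', FourierTransform.fourier_fourierInv_eq]

/-- Differentiation in Fourier space is multiplication by `i r` in real space. -/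
theorem hasDerivAt_invFourierSchwartz (ψ : 𝓢(ℝ, ℂ)) (κ : ℝ) :
    HasDerivAt (invFourierSchwartz ψ)
      (invFourierSchwartz (smulLeftCLM ℂ (fun r : ℝ => Complex.I * r) ψ) κ) κ := by
  have hgrow : (fun r : ℝ => Complex.I * (r : ℂ)).HasTemperateGrowth := by fun_prop
  have hd := (𝓕⁻ ψ).hasDerivAt (scaling κ)
  have hs : HasDerivAt (fun κ : ℝ => (2 * Real.pi)⁻¹ * κ) (2 * Real.pi)⁻¹ κ := by
    simpa using (hasDerivAt_id κ).const_mul (2 * Real.pi)⁻¹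
  have h := (hd.scomp κ hs).const_mul (2 * Real.pi : ℂ)⁻¹
  refine h.congr_deriv ?_
  have h1 : deriv (𝓕⁻ ψ : 𝓢(ℝ, ℂ)) (scaling κ)
      = (𝓕⁻ ((2 * Real.pi * Complex.I : ℂ) • smulLeftCLM ℂ (inner ℝ · (1 : ℝ)) ψ) : 𝓢(ℝ, ℂ))
        (scaling κ) := by
    rw [← lineDerivOp_fourierInv_eq, lineDerivOp_apply_eq_fderiv, fderiv_apply_one_eq_deriv]
  have h2 : ((2 * Real.pi * Complex.I : ℂ) • smulLeftCLM ℂ (inner ℝ · (1 : ℝ)) ψ)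
      = (2 * Real.pi : ℂ) • smulLeftCLM ℂ (fun r : ℝ => Complex.I * r) ψ := by
    ext x
    rw [_root_.smul_apply, _root_.smul_apply, smulLeftCLM_apply_apply (by fun_prop),
      smulLeftCLM_apply_apply hgrow]
    simp
    ring
  rw [h1, h2]
  have h3 : invFourierSchwartz (smulLeftCLM ℂ (fun r : ℝ => Complex.I * r) ψ) κ
      = (2 * Real.pi : ℂ)⁻¹
        * (𝓕⁻ (smulLeftCLM ℂ (fun r : ℝ => Complex.I * r) ψ) : 𝓢(ℝ, ℂ)) (scaling κ) := rfl
  rw [h3, FourierTransform.fourierInv_smul, _root_.smul_apply, Complex.real_smul]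
  simp only [smul_eq_mul]
  push_cast
  have := complex_two_pi_ne_zero
  field_simp

/-- The function `q` of temperate growth is the inverse Fourier transform of the finite part of
`g`, tested against Schwartz functions in real space:
`f.p. ∫ g(κ) (F⁻¹ψ)(κ) dκ = ∫ q ψ`. -/
structure IsFourierPair (g q : ℝ → ℂ) : Prop where
  growth : q.HasTemperateGrowth
  finitePart : ∀ ψ : 𝓢(ℝ, ℂ),
    HasFinitePart (fun κ => g κ * invFourierSchwartz ψ κ) (∫ r, q r * ψ r)

theorem integrable_mul_schwartz {q : ℝ → ℂ} (hq : q.HasTemperateGrowth) (ψ : 𝓢(ℝ, ℂ)) :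
    Integrable fun r => q r * ψ r := by
  refine (smulLeftCLM ℂ q ψ).integrable.congr (Eventually.of_forall fun r => ?_)
  simp [smulLeftCLM_apply_apply hq]

theorem IsFourierPair.hasInvFourier {g q : ℝ → ℂ} (h : IsFourierPair g q) :
    HasInvFourier g q := by
  -- The distribution is `φ ↦ ∫ q · Fφ`, so that its inverse Fourier transform is `q` by definition.
  have hT : ∀ φ : 𝓢(ℝ, ℂ), PointwiseConvergenceCLM.precomp ℂ fourierSchwartz
      (h.growth.toTemperedDistribution volume) φ = ∫ r, q r * fourierSchwartz φ r := by
    intro φ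
    change ∫ r, fourierSchwartz φ r • q r = _
    simp only [smul_eq_mul, mul_comm]
  refine ⟨PointwiseConvergenceCLM.precomp ℂ fourierSchwartz
    (h.growth.toTemperedDistribution volume), fun φ => ?_, fun φ =>
      ⟨integrable_mul_schwartz h.growth φ, ?_⟩⟩
  · rw [hT]
    simpa only [invFourierSchwartz_fourierSchwartz] using h.finitePart (fourierSchwartz φ)
  · rw [invFourier_apply, hT, fourierSchwartz_invFourierSchwartz]

theorem IsFourierPair.congr {g g' q q' : ℝ → ℂ} (h : IsFourierPair g q)
    (hg : ∀ κ, κ ≠ 0 → g' κ = g κ) (hq : ∀ r, q' r = q r) : IsFourierPair g' q' := by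
  obtain rfl : q' = q := funext hq
  exact ⟨h.growth, fun ψ => (h.finitePart ψ).congr fun κ hκ => by rw [hg κ hκ]⟩

theorem IsFourierPair.add {g g' q q' : ℝ → ℂ} (h : IsFourierPair g q)
    (h' : IsFourierPair g' q') :
    IsFourierPair (fun κ => g κ + g' κ) (fun r => q r + q' r) := by
  refine ⟨h.growth.add h'.growth, fun ψ => ?_⟩
  have h1 := (h.finitePart ψ).add (h'.finitePart ψ)
  rw [← integral_add (integrable_mul_schwartz h.growth ψ)
    (integrable_mul_schwartz h'.growth ψ)] at h1
  simpa only [add_mul] using h1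

theorem IsFourierPair.const_mul {g q : ℝ → ℂ} (c : ℂ) (h : IsFourierPair g q) :
    IsFourierPair (fun κ => c * g κ) (fun r => c * q r) := by
  have hq := h.growth
  refine ⟨by fun_prop, fun ψ => ?_⟩
  have h1 := (h.finitePart ψ).const_mul c
  rw [← integral_const_mul] at h1
  simpa only [mul_assoc] using h1

theorem integral_mul_smulLeftCLM {q : ℝ → ℂ} (ψ : 𝓢(ℝ, ℂ)) :
    ∫ r, q r * smulLeftCLM ℂ (fun r : ℝ => Complex.I * r) ψ r
      = ∫ r : ℝ, Complex.I * r * q r * ψ r := by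
  congr 1 with r
  rw [smulLeftCLM_apply_apply (by fun_prop), smul_eq_mul]
  ring

/-- The derivative in Fourier space of the function `w x⁻ⁿ` corresponds to multiplication by
`-i r` in real space, where the differentiation is understood as
`(w x⁻ⁿ)' = w' x⁻ⁿ - n w x⁻ⁿ⁻¹`, off the singularity. -/
theorem IsFourierPair.mul_div_pow_succ {w w' q q' : ℝ → ℂ} {n : ℕ} (hw : w.HasTemperateGrowth)
    (hd : ∀ κ, HasDerivAt w (w' κ) κ) (h : IsFourierPair (fun κ : ℝ => w κ / (κ : ℂ) ^ n) q)
    (h' : IsFourierPair (fun κ : ℝ => w' κ / (κ : ℂ) ^ n) q') :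
    IsFourierPair (fun κ : ℝ => n * (w κ / (κ : ℂ) ^ (n + 1)))
      (fun r => Complex.I * r * q r + q' r) := by
  have hq := h.growth
  have hgrow : (fun r : ℝ => Complex.I * r * q r).HasTemperateGrowth := by fun_prop
  refine ⟨hgrow.add h'.growth, fun ψ => ?_⟩
  set G := smulLeftCLM ℂ w (invFourierSchwartz ψ) with hG
  have hGx : ∀ κ, G κ = w κ * invFourierSchwartz ψ κ := fun κ => by
    rw [hG, smulLeftCLM_apply_apply hw, smul_eq_mul]
  have hderiv : ∀ κ, deriv G κ = w' κ * invFourierSchwartz ψ κ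
      + w κ * invFourierSchwartz (smulLeftCLM ℂ (fun r : ℝ => Complex.I * r) ψ) κ := by
    intro κ
    rw [show (G : ℝ → ℂ) = fun κ => w κ * invFourierSchwartz ψ κ from funext hGx]
    exact ((hd κ).mul (hasDerivAt_invFourierSchwartz ψ κ)).deriv
  have h1 := (h.finitePart (smulLeftCLM ℂ (fun r : ℝ => Complex.I * r) ψ)).add (h'.finitePart ψ)
  rw [integral_mul_smulLeftCLM, ← integral_add (integrable_mul_schwartz hgrow ψ)
    (integrable_mul_schwartz h'.growth ψ)] at h1
  have h2 := HasFinitePart.mul_div_pow_succ G n (h1.congr fun κ _ => by rw [hderiv]; ring)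
  simp only [add_mul]
  exact h2.congr fun κ _ => by rw [hGx]; ring

/-- The derivative in Fourier space of a smooth function corresponds to multiplication by `-i r`
in real space. -/
theorem IsFourierPair.deriv_of_hasTemperateGrowth {w w' q : ℝ → ℂ} (hw : w.HasTemperateGrowth)
    (hw' : w'.HasTemperateGrowth) (hd : ∀ κ, HasDerivAt w (w' κ) κ) (h : IsFourierPair w q) :
    IsFourierPair w' (fun r => -(Complex.I * r * q r)) := by
  have hq := h.growth
  refine ⟨by fun_prop, fun ψ => ?_⟩
  set φ := invFourierSchwartz ψ with hφ
  set φ' := invFourierSchwartz (smulLeftCLM ℂ (fun r : ℝ => Complex.I * r) ψ) with hφ'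
  have hi := integrable_mul_schwartz hw' φ
  have hi' := integrable_mul_schwartz hw φ'
  have h1 : ∫ κ, w κ * φ' κ = ∫ r : ℝ, Complex.I * r * q r * ψ r := by
    rw [← integral_mul_smulLeftCLM]
    exact (HasFinitePart.of_integrable hi').unique (h.finitePart _)
  have h2 : ∫ κ, w κ * φ' κ = -∫ κ, w' κ * φ κ :=
    integral_mul_deriv_eq_deriv_mul_of_integrable (fun κ _ => hd κ)
      (fun κ _ => hasDerivAt_invFourierSchwartz ψ κ)
      hi' hi (integrable_mul_schwartz hw φ)
  refine HasFinitePart.of_integrable' hi ?_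
  simp only [neg_mul, integral_neg]
  rw [← h1, h2, neg_neg]

/-- Fubini's theorem for the inverse Fourier transform of an integrable function. -/
theorem integral_mul_invFourierSchwartz {g : ℝ → ℂ} (hg : Integrable g) (ψ : 𝓢(ℝ, ℂ)) :
    ∫ κ, g κ * invFourierSchwartz ψ κ
      = ∫ r : ℝ, ((2 * Real.pi : ℂ)⁻¹ * ∫ κ : ℝ, g κ * Complex.exp (Complex.I * κ * r)) * ψ r := by
  have hprod : Integrable (fun p : ℝ × ℝ =>
      Complex.exp (Complex.I * p.1 * p.2) * (g p.1 * ψ p.2)) (volume.prod volume) := by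
    refine (hg.mul_prod ψ.integrable).bdd_mul (c := 1) (by fun_prop) ?_
    refine Eventually.of_forall fun p => ?_
    rw [mul_assoc, ← Complex.ofReal_mul, mul_comm, Complex.norm_exp_ofReal_mul_I]
  have h1 : ∀ κ, g κ * invFourierSchwartz ψ κ = (2 * Real.pi : ℂ)⁻¹ *
      ∫ r : ℝ, Complex.exp (Complex.I * κ * r) * (g κ * ψ r) := by
    intro κ
    rw [invFourierSchwartz_apply, mul_left_comm, ← integral_const_mul]
    congr 2 with r
    rw [show Complex.I * (r : ℂ) * κ = Complex.I * κ * r by ring]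
    ring
  have h2 : ∀ r : ℝ, ((2 * Real.pi : ℂ)⁻¹ * ∫ κ : ℝ, g κ * Complex.exp (Complex.I * κ * r)) * ψ r
      = (2 * Real.pi : ℂ)⁻¹ * ∫ κ : ℝ, Complex.exp (Complex.I * κ * r) * (g κ * ψ r) := by
    intro r
    rw [mul_assoc, ← integral_mul_const]
    congr 2 with κ
    ring
  simp_rw [h1, h2]
  rw [integral_const_mul, integral_const_mul, integral_integral_swap hprod]

/-! ### The Gaussian and the error function -/

theorem hasTemperateGrowth_of_hasDerivAt {f f' : ℝ → ℝ} (hd : ∀ x, HasDerivAt f (f' x) x)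
    (hf' : f'.HasTemperateGrowth) {k : ℕ} {C : ℝ} (h : ∀ x, ‖f x‖ ≤ C * (1 + ‖x‖) ^ k) :
    f.HasTemperateGrowth := by
  refine .of_fderiv ?_ (fun x => (hd x).differentiableAt) h
  have h1 : fderiv ℝ f = fun x => f' x • ContinuousLinearMap.id ℝ ℝ := by
    ext x
    rw [(hd x).hasFDerivAt.fderiv]
    simp
  rw [h1]
  fun_prop

theorem hasTemperateGrowth_exp_neg {f : ℝ → ℝ} (hf : f.HasTemperateGrowth) (h0 : ∀ x, 0 ≤ f x) :
    (fun x => Real.exp (-f x)).HasTemperateGrowth := by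
  refine Function.HasTemperateGrowth.comp' (g := Real.exp) (f := fun x => -f x) (t := Set.Iic 0)
    ?_ (uniqueDiffOn_Iic 0) Real.contDiff_exp.contDiffOn (fun N => ⟨0, 1, zero_le_one, ?_⟩)
    hf.fun_neg
  · rintro - ⟨x, rfl⟩
    simpa using h0 x
  · intro n _ x hx
    rw [norm_iteratedFDerivWithin_eq_norm_iteratedDerivWithin,
      iteratedDerivWithin_eq_iteratedDeriv (uniqueDiffOn_Iic 0) Real.contDiff_exp.contDiffAt hx,
      iteratedDeriv_eq_iterate, Real.iter_deriv_exp]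
    simpa using hx

theorem hasDerivAt_erf (x : ℝ) :
    HasDerivAt erf (2 / Real.sqrt Real.pi * Real.exp (-x ^ 2)) x := by
  have hc : Continuous fun t : ℝ => Real.exp (-t ^ 2) := by fun_prop
  exact (intervalIntegral.integral_hasDerivAt_right (hc.intervalIntegrable _ _)
    (hc.stronglyMeasurableAtFilter _ _) hc.continuousAt).const_mul _

theorem erf_zero : erf 0 = 0 := by simp [erf]

theorem hasTemperateGrowth_erf : erf.HasTemperateGrowth := by
  have hg : (fun x : ℝ => Real.exp (-x ^ 2)).HasTemperateGrowth :=
    hasTemperateGrowth_exp_neg (f := fun x => x ^ 2) (by fun_prop) (fun x => sq_nonneg x)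
  refine hasTemperateGrowth_of_hasDerivAt hasDerivAt_erf (by fun_prop) (k := 1)
    (C := 2 / Real.sqrt Real.pi) fun x => ?_
  rw [erf, norm_mul, pow_one, Real.norm_of_nonneg (by positivity : 0 ≤ 2 / Real.sqrt Real.pi)]
  gcongr
  have h := intervalIntegral.norm_integral_le_of_norm_le_const (a := 0) (b := x) (C := 1)
    (f := fun t : ℝ => Real.exp (-t ^ 2)) fun t _ => by
      rw [Real.norm_of_nonneg (Real.exp_pos _).le]
      exact Real.exp_le_one_iff.mpr (by nlinarith [sq_nonneg t])
  rw [sub_zero, one_mul, ← Real.norm_eq_abs] at h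
  linarith

/-- The Gaussian in Fourier space, `exp (-κ² / (2ξ)²)`, with complex values. -/
noncomputable def gaussHat (ξ κ : ℝ) : ℂ := ((Real.exp (-(κ ^ 2 / (2 * ξ) ^ 2)) : ℝ) : ℂ)

/-- The Gaussian in real space, normalized as the inverse Fourier transform of `gaussHat ξ`. -/
noncomputable def gauss (ξ r : ℝ) : ℂ :=
  ((ξ / Real.sqrt Real.pi * Real.exp (-(ξ ^ 2 * r ^ 2)) : ℝ) : ℂ)

variable {ξ : ℝ}

theorem hasTemperateGrowth_gaussHat : (gaussHat ξ).HasTemperateGrowth := by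
  have h := hasTemperateGrowth_exp_neg (f := fun κ => κ ^ 2 / (2 * ξ) ^ 2)
    (by simp only [div_eq_mul_inv]; fun_prop) (fun x => by positivity)
  unfold gaussHat
  fun_prop

theorem hasTemperateGrowth_gauss : (gauss ξ).HasTemperateGrowth := by
  have h := hasTemperateGrowth_exp_neg (f := fun r => ξ ^ 2 * r ^ 2)
    (by fun_prop) (fun x => by positivity)
  unfold gauss
  fun_prop

theorem continuous_gaussHat : Continuous (gaussHat ξ) := by
  unfold gaussHat
  fun_prop

theorem gaussHat_neg (κ : ℝ) : gaussHat ξ (-κ) = gaussHat ξ κ := by simp [gaussHat]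

theorem integrable_gaussHat (hξ : 0 < ξ) : Integrable (gaussHat ξ) := by
  refine ((integrable_exp_neg_mul_sq (b := ((2 * ξ) ^ 2)⁻¹) (by positivity)).ofReal
    (𝕜 := ℂ)).congr (Eventually.of_forall fun κ => ?_)
  simp only [gaussHat, div_eq_inv_mul, neg_mul]
  rfl

theorem hasDerivAt_gaussHat (κ : ℝ) :
    HasDerivAt (gaussHat ξ) (-(2 / (2 * ξ) ^ 2 * κ * gaussHat ξ κ)) κ := by
  have h := (((hasDerivAt_pow 2 κ).div_const ((2 * ξ) ^ 2)).fun_neg.exp).ofReal_comp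
  refine h.congr_deriv ?_
  simp only [gaussHat]
  push_cast
  ring

theorem integral_gaussHat_mul_exp (hξ : 0 < ξ) (r : ℝ) :
    (2 * Real.pi : ℂ)⁻¹ * ∫ κ : ℝ, gaussHat ξ κ * Complex.exp (Complex.I * κ * r)
      = gauss ξ r := by
  have hb : 0 < ((((2 * ξ) ^ 2)⁻¹ : ℝ) : ℂ).re := by
    rw [Complex.ofReal_re]; positivity
  have h := fourierIntegral_gaussian hb (r : ℂ)
  have h1 : ∫ κ : ℝ, gaussHat ξ κ * Complex.exp (Complex.I * κ * r)
      = ∫ x : ℝ, Complex.exp (Complex.I * r * x)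
        * Complex.exp (-((((2 * ξ) ^ 2)⁻¹ : ℝ) : ℂ) * x ^ 2) := by
    congr 1 with κ
    rw [gaussHat, mul_comm, Complex.ofReal_exp]
    congr 2
    · ring
    · push_cast; ring
  have h2 : ((Real.pi : ℂ) / ((((2 * ξ) ^ 2)⁻¹ : ℝ) : ℂ)) ^ (1 / 2 : ℂ)
      = ((2 * ξ * Real.sqrt Real.pi : ℝ) : ℂ) := by
    rw [← Complex.ofReal_div, show (1 / 2 : ℂ) = ((1 / 2 : ℝ) : ℂ) by push_cast; rfl,
      ← Complex.ofReal_cpow (by positivity), ← Real.sqrt_eq_rpow, div_inv_eq_mul,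
      Real.sqrt_mul Real.pi_pos.le, Real.sqrt_sq (by positivity), mul_comm]
  have h3 : Complex.exp (-(r : ℂ) ^ 2 / (4 * ((((2 * ξ) ^ 2)⁻¹ : ℝ) : ℂ)))
      = ((Real.exp (-(ξ ^ 2 * r ^ 2)) : ℝ) : ℂ) := by
    rw [Complex.ofReal_exp]
    congr 1
    push_cast
    have : (ξ : ℂ) ≠ 0 := by exact_mod_cast hξ.ne'
    field_simp
    ring
  rw [h1, h, h2, h3, gauss, ← Complex.ofReal_mul, ← Complex.ofReal_ofNat, ← Complex.ofReal_mul,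
    ← Complex.ofReal_inv, ← Complex.ofReal_mul]
  congr 1
  have hs : Real.sqrt Real.pi ≠ 0 := (Real.sqrt_pos.mpr Real.pi_pos).ne'
  have hs2 : Real.pi = Real.sqrt Real.pi ^ 2 := (Real.sq_sqrt Real.pi_pos.le).symm
  field_simp
  rw [← hs2]

theorem isFourierPair_gaussHat (hξ : 0 < ξ) : IsFourierPair (gaussHat ξ) (gauss ξ) := by
  refine ⟨hasTemperateGrowth_gauss, fun ψ => HasFinitePart.of_integrable'
    (integrable_mul_schwartz hasTemperateGrowth_gaussHat _) ?_⟩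
  rw [integral_mul_invFourierSchwartz (integrable_gaussHat hξ)]
  simp only [integral_gaussHat_mul_exp hξ]

/-! ### The principal value of the Gaussian divided by the frequency -/

theorem norm_gaussHat_mul_exp_sub_one_div_le (r κ : ℝ) :
    ‖gaussHat ξ κ * ((Complex.exp (Complex.I * κ * r) - 1) / κ)‖ ≤ ‖gaussHat ξ κ‖ * |r| := by
  rw [norm_mul, norm_div, Complex.norm_real, Real.norm_eq_abs, mul_assoc Complex.I,
    ← Complex.ofReal_mul]
  gcongr
  refine div_le_of_le_mul₀ (abs_nonneg _) (abs_nonneg _) ?_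
  refine (Real.norm_exp_I_mul_ofReal_sub_one_le (x := κ * r)).trans ?_
  rw [Real.norm_eq_abs, abs_mul, mul_comm]

theorem integrable_gaussHat_mul_exp_sub_one_div (hξ : 0 < ξ) (r : ℝ) :
    Integrable fun κ : ℝ => gaussHat ξ κ * ((Complex.exp (Complex.I * κ * r) - 1) / κ) := by
  refine ((integrable_gaussHat hξ).norm.mul_const |r|).mono' ?_
    (Eventually.of_forall (norm_gaussHat_mul_exp_sub_one_div_le r))
  exact (continuous_gaussHat.measurable.mul (by fun_prop)).aestronglyMeasurable

theorem integral_gaussHat_mul_exp_sub_one_div (hξ : 0 < ξ) (r : ℝ) :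
    (2 * Real.pi : ℂ)⁻¹ *
        ∫ κ : ℝ, gaussHat ξ κ * ((Complex.exp (Complex.I * κ * r) - 1) / κ)
      = Complex.I / 2 * (erf (ξ * r) : ℂ) := by
  -- Both sides vanish at `r = 0` and have the derivative `i * gauss ξ r`.
  set F : ℝ → ℝ → ℂ := fun r κ =>
    gaussHat ξ κ * ((Complex.exp (Complex.I * κ * r) - 1) / κ) with hF
  have hFd : ∀ r : ℝ, HasDerivAt (fun r => (2 * Real.pi : ℂ)⁻¹ * ∫ κ, F r κ)
      (Complex.I * gauss ξ r) r := by
    intro r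
    have h := hasDerivAt_integral_of_dominated_loc_of_deriv_le (μ := volume) (F := F)
      (F' := fun r κ => gaussHat ξ κ * Complex.exp (Complex.I * κ * r) * Complex.I)
      (x₀ := r) (s := Set.univ) (bound := fun κ => ‖gaussHat ξ κ‖) univ_mem
      (Eventually.of_forall fun s =>
        (integrable_gaussHat_mul_exp_sub_one_div hξ s).aestronglyMeasurable)
      (integrable_gaussHat_mul_exp_sub_one_div hξ r)
      (Continuous.aestronglyMeasurable (by have := continuous_gaussHat (ξ := ξ); fun_prop))
      (Eventually.of_forall fun κ s _ => ?_) (integrable_gaussHat hξ).norm ?_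
    · refine (h.2.const_mul _).congr_deriv ?_
      rw [integral_mul_const, ← integral_gaussHat_mul_exp hξ]
      ring
    · rw [norm_mul, norm_mul, mul_assoc Complex.I, ← Complex.ofReal_mul,
        mul_comm Complex.I, Complex.norm_exp_ofReal_mul_I, Complex.norm_I]
      simp
    · filter_upwards [Measure.ae_ne volume 0] with κ hκ s _
      have hκ' : (κ : ℂ) ≠ 0 := by exact_mod_cast hκ
      have h1 : HasDerivAt (fun s : ℝ => Complex.I * κ * (s : ℂ)) (Complex.I * κ) s := by
        simpa using (hasDerivAt_id s).ofReal_comp.const_mul (Complex.I * κ)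
      refine (((h1.cexp.sub_const 1).div_const (κ : ℂ)).const_mul (gaussHat ξ κ)).congr_deriv ?_
      field_simp
  have hEd : ∀ r : ℝ, HasDerivAt (fun r : ℝ => Complex.I / 2 * (erf (ξ * r) : ℂ))
      (Complex.I * gauss ξ r) r := by
    intro r
    have h1 : HasDerivAt (fun r : ℝ => ξ * r) ξ r := by
      simpa using (hasDerivAt_id r).const_mul ξ
    refine ((((hasDerivAt_erf (ξ * r)).comp r h1).ofReal_comp).const_mul
      (Complex.I / 2)).congr_deriv ?_
    rw [gauss, mul_pow]
    push_cast
    ring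
  have hconst := is_const_of_deriv_eq_zero
    (f := fun r => (2 * Real.pi : ℂ)⁻¹ * (∫ κ, F r κ) - Complex.I / 2 * (erf (ξ * r) : ℂ))
    (fun r => ((hFd r).sub (hEd r)).differentiableAt)
    (fun r => by rw [((hFd r).fun_sub (hEd r)).deriv, sub_self]) r 0
  have h0 : ∫ κ, F 0 κ = 0 := by simp [hF]
  simp only [h0, mul_zero, erf_zero, Complex.ofReal_zero, sub_self] at hconst
  exact sub_eq_zero.mp hconst

theorem setIntegral_gaussHat_div (ε : ℝ) :
    ∫ κ : ℝ in {x : ℝ | ε < |x|}, gaussHat ξ κ / κ = 0 := by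
  rw [← integral_indicator (measurableSet_outside ε)]
  set f := Set.indicator {x : ℝ | ε < |x|} (fun κ : ℝ => gaussHat ξ κ / κ) with hf
  have hodd : ∀ κ, f (-κ) = -f κ := by
    intro κ
    by_cases h : ε < |κ|
    · rw [hf, Set.indicator_of_mem (by simpa using h), Set.indicator_of_mem (by simpa using h),
        gaussHat_neg]
      push_cast
      ring
    · rw [hf, Set.indicator_of_notMem (by simpa using h),
        Set.indicator_of_notMem (by simpa using h),
        neg_zero]
  have h1 := integral_neg_eq_self f volume
  simp_rw [hodd, integral_neg] at h1
  exact self_eq_neg.mp h1.symm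

/-- The principal value of `exp (-κ² / (2ξ)²) / κ`. By Fubini's theorem and because the kernel is
odd, the truncated integral pairs `ψ` with `∫ exp (-κ² / (2ξ)²) (exp (i κ r) - 1) / κ` over
`{|κ| > ε}`, which is dominated by a multiple of `|r|`. -/
theorem isFourierPair_gaussHat_div (hξ : 0 < ξ) :
    IsFourierPair (fun κ : ℝ => gaussHat ξ κ / (κ : ℂ) ^ 1)
      (fun r => Complex.I / 2 * (erf (ξ * r) : ℂ)) := by
  have herf : (fun r => erf (ξ * r)).HasTemperateGrowth :=
    hasTemperateGrowth_erf.comp (f := fun r => ξ * r) (by fun_prop)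
  refine ⟨by fun_prop, fun ψ => HasFinitePart.of_tendsto (fun ε hε => ?_) ?_⟩
  · exact (integrableOn_div_pow (integrable_mul_schwartz hasTemperateGrowth_gaussHat
      (invFourierSchwartz ψ)) 1 hε).congr_fun (fun κ _ => by ring) (measurableSet_outside ε)
  set F : ℝ → ℝ → ℂ := fun r κ =>
    gaussHat ξ κ * ((Complex.exp (Complex.I * κ * r) - 1) / κ) with hF
  have htrunc : ∀ ε : ℝ, 0 < ε → ∫ κ : ℝ in {x : ℝ | ε < |x|},
      gaussHat ξ κ / (κ : ℂ) ^ 1 * invFourierSchwartz ψ κ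
      = ∫ r, ((2 * Real.pi : ℂ)⁻¹ * ∫ κ in {x : ℝ | ε < |x|}, F r κ) * ψ r := by
    intro ε hε
    have hi : IntegrableOn (fun κ : ℝ => gaussHat ξ κ / κ) {x : ℝ | ε < |x|} := by
      simpa using integrableOn_div_pow (integrable_gaussHat hξ) 1 hε
    have hFub := integral_mul_invFourierSchwartz
      ((integrable_indicator_iff (measurableSet_outside ε)).mpr hi) ψ
    simp_rw [← Set.indicator_mul_left, integral_indicator (measurableSet_outside ε)] at hFub
    simp only [pow_one]
    rw [hFub]
    congr 1 with r
    congr 2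
    have hsub : ∫ κ in {x : ℝ | ε < |x|}, F r κ
        = (∫ κ : ℝ in {x : ℝ | ε < |x|}, gaussHat ξ κ / κ * Complex.exp (Complex.I * κ * r))
          - ∫ κ : ℝ in {x : ℝ | ε < |x|}, gaussHat ξ κ / κ := by
      rw [← integral_sub _ hi]
      · congr 1 with κ
        rw [hF]
        ring
      · refine Integrable.mul_bdd (c := 1) hi (by fun_prop) (Eventually.of_forall fun κ => ?_)
        rw [mul_assoc, ← Complex.ofReal_mul, mul_comm, Complex.norm_exp_ofReal_mul_I]
    rw [hsub, setIntegral_gaussHat_div, sub_zero, ← integral_indicator (measurableSet_outside ε)]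
    simp_rw [Set.indicator_mul_left]
  have hlim : Tendsto (fun ε : ℝ =>
      ∫ r, ((2 * Real.pi : ℂ)⁻¹ * ∫ κ in {x : ℝ | ε < |x|}, F r κ) * ψ r) (𝓝[>] 0)
      (𝓝 (∫ r, Complex.I / 2 * (erf (ξ * r) : ℂ) * ψ r)) := by
    refine tendsto_integral_filter_of_dominated_convergence
      (fun r => ‖(2 * Real.pi : ℂ)⁻¹‖ * (∫ κ, ‖gaussHat ξ κ‖) * (‖r‖ ^ 1 * ‖ψ r‖)) ?_ ?_ ?_ ?_
    · refine Eventually.of_forall fun ε => ?_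
      refine AEStronglyMeasurable.mul (AEStronglyMeasurable.const_mul ?_ _)
        ψ.continuous.aestronglyMeasurable
      refine AEStronglyMeasurable.integral_prod_right' (f := fun p : ℝ × ℝ => F p.1 p.2) ?_
      refine Measurable.aestronglyMeasurable ?_
      exact (continuous_gaussHat.measurable.comp measurable_snd).mul (by fun_prop)
    · refine Eventually.of_forall fun ε => Eventually.of_forall fun r => ?_
      have hle : ‖∫ κ in {x : ℝ | ε < |x|}, F r κ‖ ≤ (∫ κ, ‖gaussHat ξ κ‖) * |r| := by
        rw [← integral_mul_const]
        refine (norm_integral_le_of_norm_le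
          ((integrable_gaussHat hξ).norm.mul_const |r|).integrableOn
          (Eventually.of_forall (norm_gaussHat_mul_exp_sub_one_div_le r))).trans ?_
        exact setIntegral_le_integral ((integrable_gaussHat hξ).norm.mul_const |r|)
          (Eventually.of_forall fun κ => by positivity)
      rw [norm_mul, norm_mul, pow_one, Real.norm_eq_abs, mul_assoc, mul_assoc, ← mul_assoc (∫ κ, _)]
      gcongr
    · exact (ψ.integrable_pow_mul volume 1).const_mul _
    · refine Eventually.of_forall fun r => ?_
      rw [← integral_gaussHat_mul_exp_sub_one_div hξ r]
      exact ((tendsto_setIntegral_outside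
        (integrable_gaussHat_mul_exp_sub_one_div hξ r)).const_mul _).mul_const _
  refine hlim.congr' ?_
  filter_upwards [self_mem_nhdsWithin] with ε hε
  exact (htrunc ε hε).symm

/-! ### The Gaussian and Hasimoto kernels divided by powers of the frequency -/

/-- The Hasimoto screening function along the free coordinate, with complex values. -/
noncomputable def hasimotoFree (ξ κ : ℝ) : ℂ := gaussHat ξ κ * (1 + (κ : ℂ) ^ 2 / (2 * ξ) ^ 2)

/-- The common profile of the entries of the stokeslet zero mode. It is the second
derivative of the biharmonic zero mode. -/
noncomputable def stokesletProfile (ξ r : ℝ) : ℝ :=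
  -(2 * Real.pi) * (2 * r * erf (ξ * r)
    + Real.exp (-(ξ ^ 2 * r ^ 2)) / (Real.sqrt Real.pi * ξ))

/-- The common profile of the entries of the stresslet zero mode. It is the third
derivative of the biharmonic zero mode. -/
noncomputable def stressletProfile (ξ r : ℝ) : ℝ :=
  -(4 * Real.pi) * (erf (ξ * r) + ξ * r / Real.sqrt Real.pi * Real.exp (-(ξ ^ 2 * r ^ 2)))

theorem hasTemperateGrowth_hasimotoFree : (hasimotoFree ξ).HasTemperateGrowth := by
  have h := hasTemperateGrowth_gaussHat (ξ := ξ)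
  unfold hasimotoFree
  simp only [div_eq_mul_inv]
  fun_prop

/-- The two terms of order `κ` cancel in the derivative of the Hasimoto function. -/
theorem hasDerivAt_hasimotoFree (κ : ℝ) :
    HasDerivAt (hasimotoFree ξ)
      (-(2 / ((2 * ξ) ^ 2 * (2 * ξ) ^ 2) * κ ^ 3 * gaussHat ξ κ)) κ := by
  have h1 : HasDerivAt (fun κ : ℝ => 1 + (κ : ℂ) ^ 2 / (2 * ξ) ^ 2)
      (2 * (κ : ℂ) / (2 * ξ) ^ 2) κ := by
    simpa using (((hasDerivAt_id κ).ofReal_comp.fun_pow 2).div_const ((2 * ξ : ℂ) ^ 2)).const_add 1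
  refine ((hasDerivAt_gaussHat κ).mul h1).congr_deriv ?_
  ring

theorem sqrt_pi_ne_zero : ((Real.sqrt Real.pi : ℝ) : ℂ) ≠ 0 := by
  exact_mod_cast (Real.sqrt_pos.mpr Real.pi_pos).ne'

theorem isFourierPair_id_mul_gaussHat (hξ : 0 < ξ) :
    IsFourierPair (fun κ : ℝ => κ * gaussHat ξ κ)
      (fun r => 2 * ξ ^ 2 * (Complex.I * r * gauss ξ r)) := by
  have hx : (ξ : ℂ) ≠ 0 := by exact_mod_cast hξ.ne'
  have hg := hasTemperateGrowth_gaussHat (ξ := ξ)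
  refine ((isFourierPair_gaussHat hξ).deriv_of_hasTemperateGrowth hg (by fun_prop)
    hasDerivAt_gaussHat |>.const_mul (-(2 * ξ ^ 2))).congr (fun κ _ => ?_) fun r => ?_
  · field_simp
  · ring

/-- Integration by parts from `exp (-κ² / (2ξ)²) / κ`. -/
theorem isFourierPair_gaussHat_div_sq (hξ : 0 < ξ) :
    IsFourierPair (fun κ : ℝ => gaussHat ξ κ / (κ : ℂ) ^ 2)
      (fun r => Complex.I * r * (Complex.I / 2 * (erf (ξ * r) : ℂ))
        + -(2 / (2 * ξ) ^ 2) * gauss ξ r) := by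
  refine ((isFourierPair_gaussHat_div hξ).mul_div_pow_succ hasTemperateGrowth_gaussHat
    hasDerivAt_gaussHat (((isFourierPair_gaussHat hξ).const_mul (-(2 / (2 * ξ) ^ 2))).congr
      (fun κ hκ => ?_) fun r => rfl)).congr (fun κ _ => ?_) fun r => rfl
  · have hk : (κ : ℂ) ≠ 0 := by exact_mod_cast hκ
    field_simp
  · simp

theorem isFourierPair_harmonic (hξ : 0 < ξ) :
    IsFourierPair (fun κ : ℝ => 4 * Real.pi * (gaussHat ξ κ / (κ : ℂ) ^ 2))
      (fun r => (QH ξ r : ℂ)) := by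
  have hx : (ξ : ℂ) ≠ 0 := by exact_mod_cast hξ.ne'
  have hs := sqrt_pi_ne_zero
  refine ((isFourierPair_gaussHat_div_sq hξ).const_mul (4 * Real.pi)).congr
    (fun κ _ => rfl) fun r => ?_
  simp only [QH, gauss]
  push_cast
  field_simp
  rw [Complex.I_sq]
  ring

theorem isFourierPair_hasimotoFree_div_sq (hξ : 0 < ξ) :
    IsFourierPair (fun κ : ℝ => 8 * Real.pi * (hasimotoFree ξ κ / (κ : ℂ) ^ 2))
      (fun r => (stokesletProfile ξ r : ℂ)) := by
  have hx : (ξ : ℂ) ≠ 0 := by exact_mod_cast hξ.ne'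
  have hs := sqrt_pi_ne_zero
  refine (((isFourierPair_gaussHat_div_sq hξ).add
    ((isFourierPair_gaussHat hξ).const_mul (1 / (2 * ξ) ^ 2))).const_mul (8 * Real.pi)).congr
    (fun κ hκ => ?_) fun r => ?_
  · have hk : (κ : ℂ) ≠ 0 := by exact_mod_cast hκ
    rw [hasimotoFree]
    field_simp
  · simp only [stokesletProfile, gauss]
    push_cast
    field_simp
    rw [Complex.I_sq]
    ring

theorem isFourierPair_hasimotoFree_div (hξ : 0 < ξ) :
    IsFourierPair (fun κ : ℝ => 8 * Real.pi * Complex.I * (hasimotoFree ξ κ / κ))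
      (fun r => (stressletProfile ξ r : ℂ)) := by
  have hx : (ξ : ℂ) ≠ 0 := by exact_mod_cast hξ.ne'
  have hs := sqrt_pi_ne_zero
  refine (((isFourierPair_gaussHat_div hξ).add
    ((isFourierPair_id_mul_gaussHat hξ).const_mul (1 / (2 * ξ) ^ 2))).const_mul
      (8 * Real.pi * Complex.I)).congr (fun κ hκ => ?_) fun r => ?_
  · have hk : (κ : ℂ) ≠ 0 := by exact_mod_cast hκ
    rw [hasimotoFree]
    field_simp
  · simp only [stressletProfile, gauss]
    push_cast
    field_simp
    rw [Complex.I_sq]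
    ring

/-- Integration by parts from `w κ⁻²` to `w κ⁻³` and `w κ⁻⁴`, for the Hasimoto function `w`. Here
`w' = -2 κ³ exp (-κ² / (2ξ)²) / (2ξ)⁴` vanishes to third order, so that `w' κ⁻²` and `w' κ⁻³` are
smooth. -/
theorem isFourierPair_biharmonic (hξ : 0 < ξ) :
    IsFourierPair (fun κ : ℝ => -(8 * Real.pi) * (hasimotoFree ξ κ / (κ : ℂ) ^ 4))
      (fun r => (QB ξ r : ℂ)) := by
  have hx : (ξ : ℂ) ≠ 0 := by exact_mod_cast hξ.ne'
  have hp : (Real.pi : ℂ) ≠ 0 := by exact_mod_cast Real.pi_ne_zero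
  have hs := sqrt_pi_ne_zero
  have h2 : IsFourierPair (fun κ : ℝ => hasimotoFree ξ κ / (κ : ℂ) ^ 2)
      (fun r => (8 * Real.pi : ℂ)⁻¹ * (stokesletProfile ξ r : ℂ)) :=
    ((isFourierPair_hasimotoFree_div_sq hξ).const_mul (8 * Real.pi : ℂ)⁻¹).congr
      (fun κ _ => by field_simp) fun r => rfl
  have h3 := h2.mul_div_pow_succ hasTemperateGrowth_hasimotoFree hasDerivAt_hasimotoFree
    (((isFourierPair_id_mul_gaussHat hξ).const_mul (-(2 / ((2 * ξ) ^ 2 * (2 * ξ) ^ 2)))).congr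
      (fun κ hκ => by
        have hk : (κ : ℂ) ≠ 0 := by exact_mod_cast hκ
        field_simp) fun r => rfl)
  have h3' := (h3.const_mul (1 / 2)).congr (g' := fun κ : ℝ => hasimotoFree ξ κ / (κ : ℂ) ^ 3)
    (fun κ _ => by push_cast; ring) fun r => rfl
  have h4 := h3'.mul_div_pow_succ hasTemperateGrowth_hasimotoFree hasDerivAt_hasimotoFree
    (((isFourierPair_gaussHat hξ).const_mul (-(2 / ((2 * ξ) ^ 2 * (2 * ξ) ^ 2)))).congr
      (fun κ hκ => by
        have hk : (κ : ℂ) ≠ 0 := by exact_mod_cast hκ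
        field_simp) fun r => rfl)
  refine (h4.const_mul (-(8 * Real.pi / 3))).congr (fun κ _ => ?_) fun r => ?_
  · push_cast
    ring
  · simp only [QB, stokesletProfile, gauss]
    push_cast
    field_simp
    ring_nf
    rw [Complex.I_sq]
    ring

/-! ### The kernels along the free coordinate -/

theorem norm_zeroModeVec_sq (κ : ℝ) : ‖zeroModeVec κ‖ ^ 2 = κ ^ 2 := by
  simp [EuclideanSpace.norm_sq_eq, Fin.sum_univ_three, zeroModeVec]

theorem norm_zeroModeVec_pow_four (κ : ℝ) : ‖zeroModeVec κ‖ ^ 4 = κ ^ 4 := by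
  rw [show 4 = 2 * 2 from rfl, pow_mul, pow_mul, norm_zeroModeVec_sq]

theorem zeroModeVec_apply (κ : ℝ) (j : Fin 3) : zeroModeVec κ j = if j = 2 then κ else 0 := by
  fin_cases j <;> simp [zeroModeVec]

theorem harmonicFHat_zeroModeVec (κ : ℝ) :
    harmonicFHat ξ (zeroModeVec κ) = 4 * Real.pi * (gaussHat ξ κ / (κ : ℂ) ^ 2) := by
  rw [harmonicFHat, harmonicHat, ewaldHat, norm_zeroModeVec_sq, gaussHat]
  push_cast
  ring

theorem biharmonicFHat_zeroModeVec (κ : ℝ) :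
    biharmonicFHat ξ (zeroModeVec κ)
      = -(8 * Real.pi) * (hasimotoFree ξ κ / (κ : ℂ) ^ 4) := by
  rw [biharmonicFHat, biharmonicHat, hasimotoHat, norm_zeroModeVec_sq, norm_zeroModeVec_pow_four,
    hasimotoFree, gaussHat]
  push_cast
  ring

theorem rotletFHat_zeroModeVec {κ : ℝ} (hκ : κ ≠ 0) (j l : Fin 3) :
    rotletFHat ξ (zeroModeVec κ) j l
      = -(levi j l 2 * (4 * Real.pi) * Complex.I) * (gaussHat ξ κ / (κ : ℂ) ^ 1) := by
  have hk : (κ : ℂ) ≠ 0 := by exact_mod_cast hκ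
  rw [rotletFHat, harmonicFHat_zeroModeVec, rotletSymbol]
  simp only [zeroModeVec_apply, Fin.sum_univ_three]
  simp
  field_simp

theorem stokesletFHat_zeroModeVec {κ : ℝ} (hκ : κ ≠ 0) (j l : Fin 3) :
    stokesletFHat ξ (zeroModeVec κ) j l
      = (!![1, 0, 0; 0, 1, 0; 0, 0, 0] j l : ℝ)
        * (8 * Real.pi * (hasimotoFree ξ κ / (κ : ℂ) ^ 2)) := by
  have hk : (κ : ℂ) ≠ 0 := by exact_mod_cast hκ
  rw [stokesletFHat, biharmonicFHat_zeroModeVec, stokesletSymbol, norm_zeroModeVec_sq]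
  simp only [zeroModeVec_apply, kron]
  fin_cases j <;> fin_cases l <;> simp <;> field_simp <;> simp

theorem stressletFHat_zeroModeVec {κ : ℝ} (hκ : κ ≠ 0) (j l m : Fin 3) :
    stressletFHat ξ (zeroModeVec κ) j l m
      = CT j l m * (8 * Real.pi * Complex.I * (hasimotoFree ξ κ / κ)) := by
  have hk : (κ : ℂ) ≠ 0 := by exact_mod_cast hκ
  rw [stressletFHat, biharmonicFHat_zeroModeVec, stressletSymbol, ← Complex.ofReal_pow,
    norm_zeroModeVec_sq]
  simp only [zeroModeVec_apply, kron]
  fin_cases j <;> fin_cases l <;> fin_cases m <;> simp [CT] <;> field_simp <;> ring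

/-! ### Failure of absolute convergence -/

/-- A function that behaves like a nonzero multiple of `κ⁻ⁿ` at the origin, with `1 ≤ n`, is not
integrable, whatever unimodular plane wave it is multiplied by. -/
theorem not_integrable_of_div_pow {g u : ℝ → ℂ} {n : ℕ} (hn : 1 ≤ n) (hu : Continuous u)
    (hu0 : u 0 ≠ 0) (hg : ∀ κ : ℝ, κ ≠ 0 → g κ = u κ / (κ : ℂ) ^ n) (r : ℝ) :
    ¬ Integrable fun κ : ℝ => Complex.exp (Complex.I * κ * r) • g κ := by
  intro hint
  refine not_intervalIntegrable_of_sub_inv_isBigO_punctured (c := 0) (a := -1) (b := 1) ?_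
    (by norm_num) (by simp) hint.intervalIntegrable
  refine Asymptotics.IsBigO.of_bound (‖u 0‖ / 2)⁻¹ ?_
  have h1 : ∀ᶠ κ in 𝓝 (0 : ℝ), ‖u 0‖ / 2 < ‖u κ‖ :=
    hu.norm.continuousAt.eventually (lt_mem_nhds (half_lt_self (norm_pos_iff.mpr hu0)))
  filter_upwards [nhdsWithin_le_nhds h1, nhdsWithin_le_nhds (Metric.ball_mem_nhds (0 : ℝ) one_pos),
    self_mem_nhdsWithin] with κ hκ hκ1 hκ0
  have hk0 : 0 < |κ| := abs_pos.mpr hκ0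
  have hk1 : |κ| ≤ 1 := by simpa using (Metric.mem_ball.mp hκ1).le
  have hexp : ‖Complex.exp (Complex.I * κ * r)‖ = 1 := by
    rw [mul_assoc, ← Complex.ofReal_mul, mul_comm, Complex.norm_exp_ofReal_mul_I]
  have hpow : |κ| ^ n ≤ |κ| := pow_le_of_le_one hk0.le hk1 (by omega)
  have hu2 : 0 < ‖u 0‖ / 2 := by positivity
  rw [norm_smul, hexp, one_mul, hg κ hκ0, norm_div, norm_pow, Complex.norm_real, sub_zero,
    norm_inv, Real.norm_eq_abs, ← div_eq_inv_mul, le_div_iff₀ hu2, ← div_eq_inv_mul]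
  gcongr

theorem not_integrable_exp_smul_of_apply {ι : Type*} [Fintype ι] {E : ι → Type*}
    [∀ i, NormedAddCommGroup (E i)] [∀ i, NormedSpace ℂ (E i)] {c : ℝ → ℂ} {f : ℝ → ∀ i, E i}
    (i : ι) (h : ¬ Integrable fun κ => c κ • f κ i) : ¬ Integrable fun κ => c κ • f κ :=
  fun hf => h (hf.eval i)

theorem gaussHat_zero : gaussHat ξ 0 = 1 := by simp [gaussHat]

theorem hasimotoFree_zero : hasimotoFree ξ 0 = 1 := by simp [hasimotoFree, gaussHat]

theorem continuous_hasimotoFree : Continuous (hasimotoFree ξ) :=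
  hasTemperateGrowth_hasimotoFree.1.continuous

/-! ### The differential relations -/

/-- On functions of the free coordinate `r₃`, only the third partial derivative is nonzero. -/
theorem pd_ofFree {q q' : ℝ → ℝ} (h : ∀ x, HasDerivAt q (q' x) x) (j : Fin 3) :
    pd j (ofFree q) = fun r => if j = 2 then q' (r 2) else 0 := by
  ext r
  have h1 : HasFDerivAt (fun r : E3 => r 2) (EuclideanSpace.proj (𝕜 := ℝ) (2 : Fin 3)) r :=
    (EuclideanSpace.proj (𝕜 := ℝ) (2 : Fin 3)).hasFDerivAt
  have h2 : HasFDerivAt (ofFree q) _ r := (h (r 2)).comp_hasFDerivAt r h1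
  rw [pd, h2.fderiv]
  fin_cases j <;> simp

theorem pd_zero (j : Fin 3) : pd j (fun _ => 0) = fun _ => 0 := by
  ext r
  simp [pd]

theorem pd_pd_ofFree {q q' q'' : ℝ → ℝ} (h : ∀ x, HasDerivAt q (q' x) x)
    (h' : ∀ x, HasDerivAt q' (q'' x) x) (j l : Fin 3) :
    pd j (pd l (ofFree q)) = fun r => if j = 2 ∧ l = 2 then q'' (r 2) else 0 := by
  rw [pd_ofFree h]
  by_cases hl : l = 2
  · simp only [hl, if_true, and_true]
    exact pd_ofFree h' j
  · simp only [hl, if_false, and_false, pd_zero]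

theorem lap_ofFree {q q' q'' : ℝ → ℝ} (h : ∀ x, HasDerivAt q (q' x) x)
    (h' : ∀ x, HasDerivAt q' (q'' x) x) : lap (ofFree q) = ofFree q'' := by
  ext r
  simp [lap, pd_pd_ofFree h h', ofFree]

theorem hasDerivAt_erf_mul (r : ℝ) : HasDerivAt (fun r => erf (ξ * r))
    (2 * ξ / Real.sqrt Real.pi * Real.exp (-(ξ ^ 2 * r ^ 2))) r := by
  have h1 : HasDerivAt (fun r : ℝ => ξ * r) ξ r := by
    simpa using (hasDerivAt_id r).const_mul ξ
  refine ((hasDerivAt_erf (ξ * r)).comp r h1).congr_deriv ?_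
  rw [mul_pow]
  ring

theorem hasDerivAt_exp_neg (r : ℝ) : HasDerivAt (fun r => Real.exp (-(ξ ^ 2 * r ^ 2)))
    (-(2 * ξ ^ 2 * r) * Real.exp (-(ξ ^ 2 * r ^ 2))) r := by
  refine (((hasDerivAt_pow 2 r).const_mul (ξ ^ 2)).fun_neg.exp).congr_deriv ?_
  push_cast
  ring

theorem hasDerivAt_QH (r : ℝ) :
    HasDerivAt (QH ξ) (-(2 * Real.pi) * erf (ξ * r)) r := by
  have hs : Real.sqrt Real.pi ≠ 0 := (Real.sqrt_pos.mpr Real.pi_pos).ne'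
  refine ((((hasDerivAt_id' r).fun_mul (hasDerivAt_erf_mul r)).fun_add
    ((hasDerivAt_exp_neg r).div_const (Real.sqrt Real.pi * ξ))).const_mul (-(2 * Real.pi))).congr_deriv ?_
  field_simp
  ring

/-- The first derivative of the biharmonic zero mode. -/
noncomputable def derivQB (ξ r : ℝ) : ℝ :=
  -(2 * Real.pi) * (r ^ 2 * erf (ξ * r)
    + r * (Real.exp (-(ξ ^ 2 * r ^ 2)) / (Real.sqrt Real.pi * ξ)))

theorem hasDerivAt_QB (hξ : 0 < ξ) (r : ℝ) : HasDerivAt (QB ξ) (derivQB ξ r) r := by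
  have hs : Real.sqrt Real.pi ≠ 0 := (Real.sqrt_pos.mpr Real.pi_pos).ne'
  refine ((((hasDerivAt_pow 3 r).fun_mul (hasDerivAt_erf_mul r)).fun_add
    (((hasDerivAt_exp_neg r).div_const (Real.sqrt Real.pi * ξ)).fun_mul
      ((hasDerivAt_pow 2 r).sub_const (1 / (2 * ξ ^ 2))))).const_mul
        (-(2 * Real.pi / 3))).congr_deriv ?_
  rw [derivQB]
  field_simp
  push_cast
  ring

theorem hasDerivAt_derivQB (hξ : 0 < ξ) (r : ℝ) :
    HasDerivAt (derivQB ξ) (stokesletProfile ξ r) r := by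
  have hs : Real.sqrt Real.pi ≠ 0 := (Real.sqrt_pos.mpr Real.pi_pos).ne'
  refine ((((hasDerivAt_pow 2 r).fun_mul (hasDerivAt_erf_mul r)).fun_add
    ((hasDerivAt_id' r).fun_mul ((hasDerivAt_exp_neg r).div_const
      (Real.sqrt Real.pi * ξ)))).const_mul (-(2 * Real.pi))).congr_deriv ?_
  rw [stokesletProfile]
  field_simp
  push_cast
  ring

theorem hasDerivAt_stokesletProfile (r : ℝ) :
    HasDerivAt (stokesletProfile ξ) (stressletProfile ξ r) r := by
  have hs : Real.sqrt Real.pi ≠ 0 := (Real.sqrt_pos.mpr Real.pi_pos).ne'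
  refine (((((hasDerivAt_id' r).const_mul 2).fun_mul (hasDerivAt_erf_mul r)).fun_add
    ((hasDerivAt_exp_neg r).div_const (Real.sqrt Real.pi * ξ))).const_mul
      (-(2 * Real.pi))).congr_deriv ?_
  rw [stressletProfile]
  field_simp
  ring

theorem QRotlet_eq (r : ℝ) (j l : Fin 3) :
    QRotlet ξ r j l = levi j l 2 * (2 * Real.pi * erf (ξ * r)) := by
  rw [QRotlet, levi]
  fin_cases j <;> fin_cases l <;> norm_num

theorem QStokeslet_eq (r : ℝ) (j l : Fin 3) :
    QStokeslet ξ r j l = !![1, 0, 0; 0, 1, 0; 0, 0, 0] j l * stokesletProfile ξ r := by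
  rw [QStokeslet, stokesletProfile, mul_comm]

theorem QStresslet_eq (r : ℝ) (j l m : Fin 3) :
    QStresslet ξ r j l m = CT j l m * stressletProfile ξ r := by
  rw [QStresslet, stressletProfile, mul_comm]

theorem rotletOp_QH (r : E3) (j l : Fin 3) :
    rotletOp j l (ofFree (QH ξ)) r = QRotlet ξ (r 2) j l := by
  simp only [rotletOp, pd_ofFree (hasDerivAt_QH), QRotlet_eq, mul_ite, mul_zero,
    Finset.sum_ite_eq', Finset.mem_univ, if_true]
  ring

theorem stokesletOp_QB (hξ : 0 < ξ) (r : E3) (j l : Fin 3) :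
    stokesletOp j l (ofFree (QB ξ)) r = QStokeslet ξ (r 2) j l := by
  rw [stokesletOp, lap_ofFree (hasDerivAt_QB hξ) (hasDerivAt_derivQB hξ),
    pd_pd_ofFree (hasDerivAt_QB hξ) (hasDerivAt_derivQB hξ), QStokeslet_eq]
  fin_cases j <;> fin_cases l <;> simp [kron, ofFree]

theorem stressletOp_QB (hξ : 0 < ξ) (r : E3) (j l m : Fin 3) :
    stressletOp j l m (ofFree (QB ξ)) r = QStresslet ξ (r 2) j l m := by
  have h3 : pd j (pd l (pd m (ofFree (QB ξ)))) r
      = if j = 2 ∧ l = 2 ∧ m = 2 then stressletProfile ξ (r 2) else 0 := by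
    rw [pd_ofFree (hasDerivAt_QB hξ)]
    by_cases hm : m = 2
    · simp only [hm, if_true, and_true]
      exact congrFun (pd_pd_ofFree (hasDerivAt_derivQB hξ) (hasDerivAt_stokesletProfile) j l) r
    · simp only [hm, if_false, and_false, pd_zero]
  rw [stressletOp, h3, lap_ofFree (hasDerivAt_QB hξ) (hasDerivAt_derivQB hξ)]
  simp only [pd_ofFree (hasDerivAt_stokesletProfile), QStresslet_eq]
  fin_cases j <;> fin_cases l <;> fin_cases m <;> simp [kron, CT] <;> ring

/-! ### Smoothness -/

theorem contDiff_erf_mul : ContDiff ℝ ∞ fun r => erf (ξ * r) :=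
  hasTemperateGrowth_erf.1.comp (by fun_prop)

theorem contDiff_QH : ContDiff ℝ ∞ (QH ξ) := by
  have h := contDiff_erf_mul (ξ := ξ)
  unfold QH
  fun_prop

theorem contDiff_QB : ContDiff ℝ ∞ (QB ξ) := by
  have h := contDiff_erf_mul (ξ := ξ)
  unfold QB
  fun_prop

end ZeroMode

theorem mainTheorem5 (ξ : ℝ) (hξ : 0 < ξ) :
    -- the zero-mode integrals do not exist in the Lebesgue sense
    (∀ r : ℝ,
      (¬ Integrable fun κ : ℝ =>
        Complex.exp (Complex.I * κ * r) • ZeroMode.harmonicFHat ξ (ZeroMode.zeroModeVec κ)) ∧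
      (¬ Integrable fun κ : ℝ =>
        Complex.exp (Complex.I * κ * r) • ZeroMode.biharmonicFHat ξ (ZeroMode.zeroModeVec κ)) ∧
      (¬ Integrable fun κ : ℝ =>
        Complex.exp (Complex.I * κ * r) • ZeroMode.rotletFHat ξ (ZeroMode.zeroModeVec κ)) ∧
      (¬ Integrable fun κ : ℝ =>
        Complex.exp (Complex.I * κ * r) • ZeroMode.stokesletFHat ξ (ZeroMode.zeroModeVec κ)) ∧
      (¬ Integrable fun κ : ℝ =>
        Complex.exp (Complex.I * κ * r) • ZeroMode.stressletFHat ξ (ZeroMode.zeroModeVec κ))) ∧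
    -- the distributional inverse Fourier transforms for the harmonic and the biharmonic kernel
    ZeroMode.HasInvFourier (fun κ => ZeroMode.harmonicFHat ξ (ZeroMode.zeroModeVec κ))
      (fun r => (ZeroMode.QH ξ r : ℂ)) ∧
    ZeroMode.HasInvFourier (fun κ => ZeroMode.biharmonicFHat ξ (ZeroMode.zeroModeVec κ))
      (fun r => (ZeroMode.QB ξ r : ℂ)) ∧
    -- the distributional inverse Fourier transforms for the rotlet, stokeslet and stresslet
    (∀ j l : Fin 3,
      ZeroMode.HasInvFourier (fun κ => ZeroMode.rotletFHat ξ (ZeroMode.zeroModeVec κ) j l)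
        (fun r => (ZeroMode.QRotlet ξ r j l : ℂ))) ∧
    (∀ j l : Fin 3,
      ZeroMode.HasInvFourier (fun κ => ZeroMode.stokesletFHat ξ (ZeroMode.zeroModeVec κ) j l)
        (fun r => (ZeroMode.QStokeslet ξ r j l : ℂ))) ∧
    (∀ j l m : Fin 3,
      ZeroMode.HasInvFourier (fun κ => ZeroMode.stressletFHat ξ (ZeroMode.zeroModeVec κ) j l m)
        (fun r => (ZeroMode.QStresslet ξ r j l m : ℂ))) ∧
    -- the tensors arise from the smooth functions `QH`, `QB` by the differential operators
    ContDiff ℝ ∞ (ZeroMode.QH ξ) ∧ ContDiff ℝ ∞ (ZeroMode.QB ξ) ∧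
    (∀ (r : ZeroMode.E3) (j l : Fin 3),
      ZeroMode.rotletOp j l (ZeroMode.ofFree (ZeroMode.QH ξ)) r
        = ZeroMode.QRotlet ξ (r 2) j l) ∧
    (∀ (r : ZeroMode.E3) (j l : Fin 3),
      ZeroMode.stokesletOp j l (ZeroMode.ofFree (ZeroMode.QB ξ)) r
        = ZeroMode.QStokeslet ξ (r 2) j l) ∧
    (∀ (r : ZeroMode.E3) (j l m : Fin 3),
      ZeroMode.stressletOp j l m (ZeroMode.ofFree (ZeroMode.QB ξ)) r
        = ZeroMode.QStresslet ξ (r 2) j l m) := by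
  open ZeroMode in
  refine ⟨fun r => ⟨?_, ?_, ?_, ?_, ?_⟩, ?_, ?_, fun j l => ?_, fun j l => ?_, fun j l m => ?_,
    contDiff_QH, contDiff_QB, rotletOp_QH, stokesletOp_QB hξ, stressletOp_QB hξ⟩
  · refine not_integrable_of_div_pow (n := 2) (u := fun κ => 4 * Real.pi * gaussHat ξ κ)
      (by norm_num) (continuous_const.mul continuous_gaussHat)
      (by simp [gaussHat_zero, Real.pi_ne_zero]) (fun κ _ => ?_) r
    rw [harmonicFHat_zeroModeVec, mul_div_assoc]
  · refine not_integrable_of_div_pow (n := 4) (u := fun κ => -(8 * Real.pi) * hasimotoFree ξ κ)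
      (by norm_num) (continuous_const.mul continuous_hasimotoFree)
      (by simp [hasimotoFree_zero, Real.pi_ne_zero]) (fun κ _ => ?_) r
    rw [biharmonicFHat_zeroModeVec, mul_div_assoc]
  -- the entry `(1, 2)` of the rotlet
  · refine not_integrable_exp_smul_of_apply 0 (not_integrable_exp_smul_of_apply 1
      (not_integrable_of_div_pow (n := 1)
        (u := fun κ => -(levi 0 1 2 * (4 * Real.pi) * Complex.I) * gaussHat ξ κ)
        le_rfl (continuous_const.mul continuous_gaussHat)
        (by simp [gaussHat_zero, Real.pi_ne_zero, levi]; norm_num) (fun κ hκ => ?_) r))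
    rw [rotletFHat_zeroModeVec hκ, mul_div_assoc]
  -- the entry `(1, 1)` of the stokeslet
  · refine not_integrable_exp_smul_of_apply 0 (not_integrable_exp_smul_of_apply 0
      (not_integrable_of_div_pow (n := 2) (u := fun κ => 8 * Real.pi * hasimotoFree ξ κ)
        (by norm_num) (continuous_const.mul continuous_hasimotoFree)
        (by simp [hasimotoFree_zero, Real.pi_ne_zero]) (fun κ hκ => ?_) r))
    rw [stokesletFHat_zeroModeVec hκ, mul_div_assoc]
    simp
  -- the entry `(3, 3, 3)` of the stresslet
  · refine not_integrable_exp_smul_of_apply 2 (not_integrable_exp_smul_of_apply 2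
      (not_integrable_exp_smul_of_apply 2 (not_integrable_of_div_pow (n := 1)
        (u := fun κ => 8 * Real.pi * Complex.I * hasimotoFree ξ κ)
        le_rfl (continuous_const.mul continuous_hasimotoFree)
        (by simp [hasimotoFree_zero, Real.pi_ne_zero]) (fun κ hκ => ?_) r)))
    rw [stressletFHat_zeroModeVec hκ, mul_div_assoc]
    simp [CT]
  · exact ((isFourierPair_harmonic hξ).congr (fun κ _ => harmonicFHat_zeroModeVec κ)
      fun r => rfl).hasInvFourier
  · exact ((isFourierPair_biharmonic hξ).congr (fun κ _ => biharmonicFHat_zeroModeVec κ)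
      fun r => rfl).hasInvFourier
  · refine (((isFourierPair_gaussHat_div hξ).const_mul
      (-(levi j l 2 * (4 * Real.pi) * Complex.I))).congr
      (fun κ hκ => rotletFHat_zeroModeVec hκ j l) fun r => ?_).hasInvFourier
    rw [QRotlet_eq]
    push_cast
    linear_combination (2 * levi j l 2 * Real.pi * erf (ξ * r) : ℂ) * Complex.I_sq
  · refine (((isFourierPair_hasimotoFree_div_sq hξ).const_mul _).congr
      (fun κ hκ => stokesletFHat_zeroModeVec hκ j l) fun r => ?_).hasInvFourier
    rw [QStokeslet_eq, Complex.ofReal_mul]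
  · refine (((isFourierPair_hasimotoFree_div hξ).const_mul _).congr
      (fun κ hκ => stressletFHat_zeroModeVec hκ j l m) fun r => ?_).hasInvFourier
    rw [QStresslet_eq, Complex.ofReal_mul]
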